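/- Let $B>0$, let $D=\{(x,y)\in\mathbb R^2:\ x>0,\ 0<y<B\}$ be the right half-strip, and let $\|\cdot\|$ be the norm of $L^2(D)$. Let $\gamma\le 0$ and $k\in(0,\tfrac14)$. Let $u_0\in H^4(D)$ with $\partial_x^5u_0\in L^2(D)$ satisfy $$u_0(0,y)=u_{0x}(0,y)=0,\qquad u_0(x,0)=u_0(x,B)=u_{0yy}(x,0)=u_{0yy}(x,B)=0,$$ $$\lim_{x\to+\infty}\partial_x^iu_0(x,y)=0\quad(i=0,1,2,3),$$ $$\int_D e^{kx}\bigl[|\Delta^2u_0|^2+|\Delta u_0|^2+u_0^2u_{0x}^2+|\partial_x^5u_0|^2\bigr]\,dx\,dy<\infty .$$ Let $u$ be a global regular solution of the problem $$u_t+\Delta^2u+\gamma\Delta u+\Delta u_x+uu_x-\partial_x^5u=0\quad\text{in } D\times(0,\infty),$$ $$u|_{\partial D}=0,\qquad u_x(0,y,t)=0,\qquad u_{yy}(x,0,t)=u_{yy}(x,B,t)=0,$$ $$u(x,y,0)=u_0(x,y),\quad (x,y)\in D,$$ that is, for every $T>0$, $$u\in L^\infty(0,T;H^2(D))\cap L^2(0,T;H^4(D)),\qquad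 \partial_x^5u\in L^2(0,T;L^2(D)),$$ $$u_t\in L^\infty(0,T;L^2(D))\cap L^2(0,T;H^2(D)),$$ the equation holds almost everywhere, the boundary conditions hold for almost every $t>0$, and $u$, taken as a continuous function $[0,\infty)\to L^2(D)$, satisfies $u(0)=u_0$. Then for all $t\ge 0$ $$\|u(t)\|^2\le\|u_0\|^2e^{-\chi t},\qquad\text{where}\quad \chi=2\Bigl(\frac{|\gamma|}{a}+1\Bigr)a^2,\quad a=\frac{\pi^2}{B^2}.$$ -/

import Mathlib

open MeasureTheory Set Filter Topology
open scoped ContDiff ENNReal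

/-- The right half-strip `D = (0, ∞) × (0, B)`. -/
def halfStrip (B : ℝ) : Set (ℝ × ℝ) := Ioi 0 ×ˢ Ioo 0 B

/-- Lebesgue measure on the half-strip. -/
noncomputable abbrev stripMeasure (B : ℝ) : Measure (ℝ × ℝ) := volume.restrict (halfStrip B)

/-- The real Hilbert space `L²(D)`. -/
noncomputable abbrev StripL2 (B : ℝ) : Type := Lp ℝ 2 (stripMeasure B)

/-- `∂φ/∂x` (only applied to smooth functions). -/
noncomputable def dX (φ : ℝ × ℝ → ℝ) : ℝ × ℝ → ℝ := fun p => fderiv ℝ φ p (1, 0)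

/-- `∂φ/∂y` (only applied to smooth functions). -/
noncomputable def dY (φ : ℝ × ℝ → ℝ) : ℝ × ℝ → ℝ := fun p => fderiv ℝ φ p (0, 1)

/-- `g` is the weak derivative `∂_x^i ∂_y^j f` on `D`, tested against `C_0^∞(D)`. -/
def HasWeakDeriv (B : ℝ) (i j : ℕ) (f g : StripL2 B) : Prop :=
  ∀ φ : ℝ × ℝ → ℝ, ContDiff ℝ ∞ φ → HasCompactSupport φ → tsupport φ ⊆ halfStrip B →
    ∫ p in halfStrip B, f p * (dX^[i] (dY^[j] φ)) p =
      (-1) ^ (i + j) * ∫ p in halfStrip B, g p * φ p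

/-- The orders `(i, j)` of the derivatives `∂_x^i ∂_y^j` controlled by
"`f ∈ H⁴(D)` and `∂_x^5 f ∈ L²(D)`". -/
def RegularOrder (i j : ℕ) : Prop := i + j ≤ 4 ∨ (i = 5 ∧ j = 0)

/-- `f ∈ H⁴(D)` and `∂_x^5 f ∈ L²(D)`, with weak derivatives `F i j = ∂_x^i ∂_y^j f`. -/
def HasRegularDerivs (B : ℝ) (f : StripL2 B) (F : ℕ → ℕ → StripL2 B) : Prop :=
  ∀ i j, RegularOrder i j → HasWeakDeriv B i j f (F i j)

/-- The side `x = 0` of the half-strip. -/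
def leftSide (B : ℝ) : Set (ℝ × ℝ) := {0} ×ˢ Icc 0 B

/-- The sides `y = 0` and `y = B` of the half-strip. -/
def horizontalSides (B : ℝ) : Set (ℝ × ℝ) := Ici 0 ×ˢ {0, B}

/-- `f = 0` on `Γ ⊆ ∂D`: the representative of `f` that is continuous up to the boundary vanishes
on `Γ`. It is only used for functions in `H²(D)`, which always have such a representative. -/
def VanishesOn (B : ℝ) (f : StripL2 B) (Γ : Set (ℝ × ℝ)) : Prop :=
  ∃ v : ℝ × ℝ → ℝ, ContinuousOn v (closure (halfStrip B)) ∧ v =ᵐ[stripMeasure B] f ∧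
    ∀ p ∈ Γ, v p = 0

/-- The boundary conditions `u|_{∂D} = 0`, `u_x(0, y) = 0`, `u_yy(x, 0) = u_yy(x, B) = 0`, for a
function with weak derivatives `F i j = ∂_x^i ∂_y^j u` (so `F 0 0 = u`). -/
def BoundaryConditions (B : ℝ) (F : ℕ → ℕ → StripL2 B) : Prop :=
  VanishesOn B (F 0 0) (leftSide B ∪ horizontalSides B) ∧
  VanishesOn B (F 1 0) (leftSide B) ∧
  VanishesOn B (F 0 2) (horizontalSides B)

/-- `f → 0` as `x → +∞`, for the continuous representative of `f`. -/
def TendsToZeroAtInfinity (B : ℝ) (f : StripL2 B) : Prop :=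
  ∃ v : ℝ × ℝ → ℝ, ContinuousOn v (halfStrip B) ∧ v =ᵐ[stripMeasure B] f ∧
    ∀ y ∈ Ioo 0 B, Tendsto (fun x => v (x, y)) atTop (𝓝 0)

/-- The conditions on the initial function: `u₀ ∈ H⁴(D)`, `∂_x^5 u₀ ∈ L²(D)`, the boundary
conditions, the decay of `∂_x^i u₀`, `i ≤ 3`, as `x → +∞`, and
`∫_D e^{kx} (|Δ²u₀|² + |Δu₀|² + u₀² u₀ₓ² + |∂_x^5 u₀|²) dx dy < ∞`. -/
def AdmissibleData (B k : ℝ) (u₀ : StripL2 B) : Prop :=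
  ∃ F : ℕ → ℕ → StripL2 B,
    HasRegularDerivs B u₀ F ∧
    BoundaryConditions B F ∧
    (∀ i ≤ 3, TendsToZeroAtInfinity B (F i 0)) ∧
    Integrable (fun p : ℝ × ℝ => Real.exp (k * p.1) *
      ((F 4 0 p + 2 * F 2 2 p + F 0 4 p) ^ 2 + (F 2 0 p + F 0 2 p) ^ 2
        + (u₀ p) ^ 2 * (F 1 0 p) ^ 2 + (F 5 0 p) ^ 2)) (stripMeasure B)

/-- `u` is a global regular solution on `D × (0, ∞)` of
`u_t + Δ²u + γΔu + Δu_x + u u_x - ∂_x^5 u = 0` with the boundary conditions above and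
`u(0) = u₀`: for every `T > 0`,
`u ∈ L^∞(0,T; H²(D)) ∩ L²(0,T; H⁴(D))`, `∂_x^5 u ∈ L²(0,T; L²(D))` and
`u_t ∈ L^∞(0,T; L²(D)) ∩ L²(0,T; H²(D))`.

Here `U i j t = ∂_x^i ∂_y^j u(t)` and `V i j t = ∂_x^i ∂_y^j u_t(t)` are the weak derivatives in the
space variables. That `V 0 0` is the time derivative `u_t` is expressed by
`u(t) = u(0) + ∫₀ᵗ u_t(s) ds` in `L²(D)`, that is, `u` is the continuous representative of a
function in `W^{1,∞}(0,T; L²(D))`. -/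
def IsGlobalRegularSolution (B γ : ℝ) (u₀ : StripL2 B) (u : ℝ → StripL2 B) : Prop :=
  ∃ U V : ℕ → ℕ → ℝ → StripL2 B,
    (∀ᵐ t ∂volume.restrict (Ioi (0 : ℝ)), HasRegularDerivs B (u t) (fun i j => U i j t)) ∧
    (∀ᵐ t ∂volume.restrict (Ioi (0 : ℝ)),
      ∀ i j, i + j ≤ 2 → HasWeakDeriv B i j (V 0 0 t) (V i j t)) ∧
    (∀ T > 0,
      (∀ i j, i + j ≤ 2 → MemLp (U i j) ∞ (volume.restrict (Ioo 0 T))) ∧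
      (∀ i j, RegularOrder i j → MemLp (U i j) 2 (volume.restrict (Ioo 0 T))) ∧
      MemLp (V 0 0) ∞ (volume.restrict (Ioo 0 T)) ∧
      (∀ i j, i + j ≤ 2 → MemLp (V i j) 2 (volume.restrict (Ioo 0 T)))) ∧
    (∀ t ≥ 0, u t = u 0 + ∫ s in (0 : ℝ)..t, V 0 0 s) ∧
    (∀ᵐ t ∂volume.restrict (Ioi (0 : ℝ)), ∀ᵐ p ∂stripMeasure B,
      V 0 0 t p + (U 4 0 t p + 2 * U 2 2 t p + U 0 4 t p) + γ * (U 2 0 t p + U 0 2 t p)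
        + (U 3 0 t p + U 1 2 t p) + u t p * U 1 0 t p - U 5 0 t p = 0) ∧
    (∀ᵐ t ∂volume.restrict (Ioi (0 : ℝ)), BoundaryConditions B (fun i j => U i j t)) ∧
    u 0 = u₀

/-! Pairing the equation with u in L²(D) gives ½ d/dt ‖u‖² = −∫(Au)u, where A is the linear part:
the transport term contributes ∫u²u_x = ∫∂_x(u³/3) = 0
(`HasRegularDerivs.integral_sq_mul_dx_eq_zero`). It remains to show ∫(Au)u ≥ c‖u‖² with c = a² +
|γ|a = χ/2, and to integrate in time (`norm_sq_le_exp_of_ae_inner_le`).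

The coercivity is diagonal in y. Since u and u_yy vanish at y = 0 and y = B, taking the coefficient
against sin(nπy/B) turns ∂_y² into −λ, λ = (nπ/B)². A sine coefficient g(x) of u has g(0) = g'(0) =
0, and integration by parts on the half-line turns its energy into ∫g''² + (2λ − γ)∫g'² + (λ² −
γλ)∫g² + g''(0)²/2; the terms of order one and three in x drop out, and the last term comes from
−∂_x⁵. As γ ≤ 0 and λ ≥ a for n ≠ 0, this is at least c∫g² (`energy_nonneg_of_weakDeriv`). Parseval
in y sums the modes (`integral_mul_nonneg_of_sineMode`, `HasRegularDerivs.energy_nonneg`).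

All derivatives are weak. The moments ∫u(x,y)η(y)dy and ∫u(x,y)φ(x)dx reduce weak derivatives on D
to weak derivatives in one variable, where a function is a primitive of its weak derivative
(`exists_ae_eq_primitive`); boundary values are then read off from continuous representatives. -/

/-! ### Test functions and weak derivatives in one variable. -/

/-- Test functions on the open set `I ⊆ ℝ`. -/
structure IsTest (I : Set ℝ) (φ : ℝ → ℝ) : Prop where
  contDiff : ContDiff ℝ ∞ φ
  compact : HasCompactSupport φ
  tsupport_subset : tsupport φ ⊆ I

namespace IsTest

variable {I : Set ℝ} {φ ψ : ℝ → ℝ}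

theorem deriv (h : IsTest I φ) : IsTest I (deriv φ) where
  contDiff := (contDiff_infty_iff_deriv.1 h.contDiff).2
  compact := h.compact.deriv
  tsupport_subset := (closure_minimal support_deriv_subset (isClosed_tsupport φ)).trans
    h.tsupport_subset

theorem iterate_deriv (h : IsTest I φ) (n : ℕ) : IsTest I (_root_.deriv^[n] φ) := by
  induction n generalizing φ with
  | zero => exact h
  | succ n ih => exact ih h.deriv

theorem continuous (h : IsTest I φ) : Continuous φ := h.contDiff.continuous

theorem differentiable (h : IsTest I φ) : Differentiable ℝ φ :=
  h.contDiff.differentiable (by simp)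

theorem sub_const_mul (h : IsTest I φ) (k : IsTest I ψ) (c : ℝ) :
    IsTest I (fun x => φ x - c * ψ x) where
  contDiff := h.contDiff.sub (contDiff_const.mul k.contDiff)
  compact := h.compact.sub (k.compact.mul_left (f := fun _ => c))
  tsupport_subset := by
    refine (closure_minimal (fun x hx => ?_)
      ((isClosed_tsupport φ).union (isClosed_tsupport ψ))).trans
      (union_subset h.tsupport_subset k.tsupport_subset)
    by_contra hn
    simp only [mem_union, not_or] at hn
    exact hx (by simp [image_eq_zero_of_notMem_tsupport hn.1,
      image_eq_zero_of_notMem_tsupport hn.2])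

theorem eq_zero_of_notMem (h : IsTest I φ) {x : ℝ} (hx : x ∉ I) : φ x = 0 :=
  image_eq_zero_of_notMem_tsupport fun hx' => hx (h.tsupport_subset hx')

theorem integrable (h : IsTest I φ) : Integrable φ :=
  h.continuous.integrable_of_hasCompactSupport h.compact

theorem memLp (h : IsTest I φ) (s : Set ℝ) : MemLp φ 2 (volume.restrict s) :=
  (h.continuous.memLp_of_hasCompactSupport h.compact).restrict s

/-- A test function of integral zero is the derivative of a test function. -/
theorem exists_deriv_eq (h : IsTest I φ) (hI : I.OrdConnected) (h0 : ∫ x, φ x = 0) :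
    ∃ Φ, IsTest I Φ ∧ _root_.deriv Φ = φ := by
  rcases (tsupport φ).eq_empty_or_nonempty with he | hne
  · have : φ = 0 := by simpa [tsupport_eq_empty_iff] using he
    subst this
    exact ⟨0, ⟨contDiff_const, HasCompactSupport.zero, by simp⟩, by simp⟩
  obtain ⟨a, ha⟩ := IsCompact.exists_isLeast h.compact hne
  obtain ⟨b, hb⟩ := IsCompact.exists_isGreatest h.compact hne
  -- Integrating from the left end a of the support makes Φ vanish before a; the zero mean makes it
  -- vanish after b.
  let Φ : ℝ → ℝ := fun x => ∫ t in a..x, φ t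
  have hd : ∀ x, HasDerivAt Φ (φ x) x := fun x =>
    intervalIntegral.integral_hasDerivAt_right (h.continuous.intervalIntegrable _ _)
      (h.continuous.stronglyMeasurableAtFilter _ _) h.continuous.continuousAt
  have hdΦ : _root_.deriv Φ = φ := funext fun x => (hd x).deriv
  have hlow : ∀ x < a, φ x = 0 := fun x hx =>
    image_eq_zero_of_notMem_tsupport fun hx' => absurd (ha.2 hx') (not_le.2 hx)
  have hhigh : ∀ x, b < x → φ x = 0 := fun x hx =>
    image_eq_zero_of_notMem_tsupport fun hx' => absurd (hb.2 hx') (not_le.2 hx)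
  have hsupp : Function.support Φ ⊆ Icc a b := by
    intro x hx
    by_contra hn
    apply hx
    rcases lt_or_ge x a with hxa | hxa
    · show ∫ t in a..x, φ t = 0
      rw [intervalIntegral.integral_of_ge hxa.le,
        integral_Ioc_eq_integral_Ioo,
        setIntegral_eq_zero_of_forall_eq_zero fun t ht => hlow t ht.2, neg_zero]
    · have hxb : b < x := by
        by_contra hh
        exact hn ⟨hxa, not_lt.1 hh⟩
      show ∫ t in a..x, φ t = 0
      rw [intervalIntegral.integral_of_le hxa, ← integral_Icc_eq_integral_Ioc,
        setIntegral_eq_integral_of_forall_compl_eq_zero, h0]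
      intro t ht
      by_contra hne
      have h1 : a ≤ t := not_lt.1 fun h' => hne (hlow t h')
      have h2 : t ≤ b := not_lt.1 fun h' => hne (hhigh t h')
      exact ht ⟨h1, h2.trans hxb.le⟩
  have hts : tsupport Φ ⊆ Icc a b := closure_minimal hsupp isClosed_Icc
  refine ⟨Φ, ⟨?_, ?_, ?_⟩, hdΦ⟩
  · exact contDiff_infty_iff_deriv.2 ⟨fun x => (hd x).differentiableAt, hdΦ ▸ h.contDiff⟩
  · exact isCompact_Icc.of_isClosed_subset (isClosed_tsupport _) hts
  · exact hts.trans (hI.out (h.tsupport_subset ha.1) (h.tsupport_subset hb.1))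

theorem exists_integral_eq_one (hI : IsOpen I) (hne : I.Nonempty) :
    ∃ ψ, IsTest I ψ ∧ ∫ x, ψ x = 1 := by
  obtain ⟨c, hc⟩ := hne
  obtain ⟨ε, hε, hball⟩ := Metric.isOpen_iff.1 hI c hc
  let b : ContDiffBump c := ⟨ε / 4, ε / 2, by positivity, by linarith⟩
  refine ⟨b.normed volume, ⟨b.contDiff_normed, b.hasCompactSupport_normed, ?_⟩,
    b.integral_normed⟩
  rw [b.tsupport_normed_eq]
  refine (Metric.closedBall_subset_ball ?_).trans hball
  show ε / 2 < ε
  linarith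

theorem integrable_mul (h : IsTest I φ) {f : ℝ → ℝ} (hf : LocallyIntegrableOn f I) :
    Integrable (fun x => φ x * f x) := by
  refine (integrableOn_iff_integrable_of_support_subset (s := tsupport φ) ?_).1 ?_
  · intro x hx
    by_contra hn
    exact hx (by simp [image_eq_zero_of_notMem_tsupport hn])
  · exact (hf.integrableOn_compact_subset h.tsupport_subset h.compact).continuousOn_mul
      h.continuous.continuousOn h.compact

theorem setIntegral_mul (h : IsTest I φ) (f : ℝ → ℝ) :
    ∫ x in I, f x * φ x = ∫ x, f x * φ x :=
  setIntegral_eq_integral_of_forall_compl_eq_zero fun x hx => by simp [h.eq_zero_of_notMem hx]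

end IsTest

/-- The du Bois-Reymond lemma. -/
theorem ae_eq_const_of_forall_integral_mul_deriv_eq_zero {I : Set ℝ} (hI : IsOpen I)
    (hc : I.OrdConnected) {h : ℝ → ℝ} (hh : LocallyIntegrableOn h I)
    (H : ∀ φ, IsTest I φ → ∫ x in I, h x * deriv φ x = 0) :
    ∃ c, ∀ᵐ x ∂volume.restrict I, h x = c := by
  rcases I.eq_empty_or_nonempty with rfl | hne
  · exact ⟨0, by simp⟩
  obtain ⟨ψ, hψ, hψ1⟩ := IsTest.exists_integral_eq_one hI hne
  refine ⟨∫ x, ψ x * h x, ?_⟩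
  set c := ∫ x, ψ x * h x
  have key := hI.ae_eq_zero_of_integral_contDiff_smul_eq_zero (μ := volume)
    (f := fun x => h x - c) (hh.sub ((locallyIntegrable_const c).locallyIntegrableOn I)) ?_
  · rw [ae_restrict_iff' hI.measurableSet]
    filter_upwards [key] with x hx hxI
    linarith [hx hxI]
  intro g hg1 hg2 hg3
  have hg : IsTest I g := ⟨hg1, hg2, hg3⟩
  -- Subtracting (∫g)ψ leaves a function of zero mean, hence the derivative of a test function, to
  -- which `H` applies.
  obtain ⟨Φ, hΦ, hdΦ⟩ := (hg.sub_const_mul hψ (∫ x, g x)).exists_deriv_eq hc (by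
    rw [integral_sub hg.integrable (hψ.integrable.const_mul _), integral_const_mul, hψ1]; ring)
  have h0 := H Φ hΦ
  rw [hΦ.deriv.setIntegral_mul, hdΦ] at h0
  have e1 : ∀ x, h x * (g x - (∫ x, g x) * ψ x) = g x * h x - (∫ x, g x) * (ψ x * h x) :=
    fun x => by ring
  simp_rw [e1] at h0
  rw [integral_sub (hg.integrable_mul hh) ((hψ.integrable_mul hh).const_mul _),
    integral_const_mul] at h0
  simp only [smul_eq_mul, mul_sub]
  rw [integral_sub (hg.integrable_mul hh) (hg.integrable.mul_const c), integral_mul_const]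
  exact h0

/-- The product rule for primitives of integrable functions. -/
theorem integral_primitive_mul_primitive {p p' q q' : ℝ → ℝ} {a b : ℝ}
    (hp' : IntervalIntegrable p' volume a b) (hq' : IntervalIntegrable q' volume a b)
    (hp : ∀ x ∈ uIcc a b, p x = p a + ∫ t in a..x, p' t)
    (hq : ∀ x ∈ uIcc a b, q x = q a + ∫ t in a..x, q' t) :
    ∫ x in a..b, (p' x * q x + p x * q' x) = p b * q b - p a * q a := by
  -- Primitives of integrable functions are absolutely continuous, so the product formula needs no
  -- more than integrability of p' and q'.
  have hac : ∀ {r : ℝ → ℝ} (c : ℝ), IntervalIntegrable r volume a b →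
      AbsolutelyContinuousOnInterval (fun x => c + ∫ t in a..x, r t) a b := by
    intro r c hr
    refine AbsolutelyContinuousOnInterval.add (f := fun _ => c) ?_
      (hr.absolutelyContinuousOnInterval_intervalIntegral (c := a) (by simp))
    exact (LipschitzWith.const c).lipschitzOnWith.absolutelyContinuousOnInterval
  have key := (hac (p a) hp').integral_deriv_mul_eq_sub (hac (q a) hq')
  rw [hp b (by simp), hq b (by simp)]
  simp only [intervalIntegral.integral_same, add_zero] at key
  rw [← key]
  apply intervalIntegral.integral_congr_ae
  filter_upwards [hp'.ae_hasDerivAt_integral, hq'.ae_hasDerivAt_integral] with x h1 h2 hx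
  have hx' := uIoc_subset_uIcc hx
  rw [((h1 hx' a (by simp)).const_add (p a)).deriv, ((h2 hx' a (by simp)).const_add (q a)).deriv,
    ← hp x hx', ← hq x hx']

/-- A weakly differentiable function is a primitive of its weak derivative. -/
theorem exists_ae_eq_primitive {I : Set ℝ} (hI : IsOpen I) (hc : I.OrdConnected) {e : ℝ}
    (heI : ∀ x ∈ I, e ≤ x) {f g : ℝ → ℝ} (hf : LocallyIntegrableOn f I)
    (hg : ∀ x ∈ I, IntegrableOn g (Ioc e x))
    (H : ∀ φ, IsTest I φ → ∫ x in I, f x * deriv φ x = - ∫ x in I, g x * φ x)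
    (hsub : ∀ x ∈ I, Ioo e x ⊆ I) :
    ∃ c, ∀ᵐ x ∂volume.restrict I, f x = c + ∫ t in e..x, g t := by
  have hgi : ∀ x ∈ I, IntervalIntegrable g volume e x := fun x hx =>
    (intervalIntegrable_iff_integrableOn_Ioc_of_le (heI x hx)).2 (hg x hx)
  let G : ℝ → ℝ := fun x => ∫ t in e..x, g t
  -- The base point is the excluded left end of I: I is open and e bounds it from below. Hence every
  -- test function vanishes at e.
  have heI' : e ∉ I := by
    intro he
    obtain ⟨ε, hε, hb⟩ := Metric.isOpen_iff.1 hI e he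
    have := heI (e - ε / 2) (hb (by simp [abs_of_pos hε]; linarith))
    linarith
  have hGc : ContinuousOn G I := by
    intro x hx
    obtain ⟨ε, hε, hb⟩ := Metric.isOpen_iff.1 hI x hx
    have hx2 : x + ε / 2 ∈ I := hb (by simp [abs_of_pos hε]; linarith)
    have hcont := intervalIntegral.continuousOn_primitive_interval'
      (hgi _ hx2) (left_mem_uIcc)
    have hlt : e < x := lt_of_le_of_ne (heI x hx) fun h => heI' (h ▸ hx)
    refine (hcont.continuousAt ?_).continuousWithinAt
    rw [uIcc_of_le (heI _ hx2)]
    exact Icc_mem_nhds hlt (by linarith)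
  have hG : LocallyIntegrableOn G I := hGc.locallyIntegrableOn hI.measurableSet
  obtain ⟨c, hc'⟩ := ae_eq_const_of_forall_integral_mul_deriv_eq_zero hI hc
    (h := fun x => f x - G x) (hf.sub hG) (by
    intro φ hφ
    have hi1 : IntegrableOn (fun x => f x * deriv φ x) I := by
      simpa only [mul_comm] using (hφ.deriv.integrable_mul hf).integrableOn
    have hi2 : IntegrableOn (fun x => G x * deriv φ x) I := by
      simpa only [mul_comm] using (hφ.deriv.integrable_mul hG).integrableOn
    simp only [sub_mul]
    rw [integral_sub hi1 hi2, H φ hφ, sub_eq_zero]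
    rcases (tsupport φ).eq_empty_or_nonempty with he | hne
    · have : φ = 0 := by simpa [tsupport_eq_empty_iff] using he
      subst this
      simp
    obtain ⟨b, hb⟩ := IsCompact.exists_isGreatest hφ.compact hne
    have hbI := hφ.tsupport_subset hb.1
    obtain ⟨ε, hε, hball⟩ := Metric.isOpen_iff.1 hI b hbI
    -- A point of I just beyond the support: φ vanishes at both e and b', so integration by parts on
    -- [e, b'] has no boundary term.
    set b' := b + ε / 2
    have hb' : b' ∈ I := hball (by simp [b', abs_of_pos hε]; linarith)
    have hle : e ≤ b' := heI _ hb'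
    have hφb : φ b' = 0 := image_eq_zero_of_notMem_tsupport fun h' => by
      have := hb.2 h'
      simp only [b'] at this
      linarith
    have hφ0 : φ e = 0 := hφ.eq_zero_of_notMem heI'
    have key := integral_primitive_mul_primitive (p := G) (p' := g) (q := φ) (q' := deriv φ)
      (hgi b' hb') (hφ.deriv.continuous.intervalIntegrable e b') (by simp [G]) (by
        intro x _
        rw [intervalIntegral.integral_deriv_eq_sub (fun y _ => hφ.differentiable y)
          (hφ.deriv.continuous.intervalIntegrable _ _)]
        ring)
    rw [hφb, hφ0, mul_zero, mul_zero, sub_zero, intervalIntegral.integral_of_le hle] at key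
    have htail : ∀ k : ℝ → ℝ, (∀ x, x ∉ tsupport φ → k x = 0) →
        ∫ x in I, k x = ∫ x in Ioc e b', k x := by
      intro k hk
      rw [setIntegral_eq_integral_of_forall_compl_eq_zero
        (fun x hx => hk x fun h' => hx (hφ.tsupport_subset h')),
        setIntegral_eq_integral_of_forall_compl_eq_zero]
      intro x hx
      refine hk x fun h' => hx ⟨?_, (hb.2 h').trans (by simp only [b']; linarith)⟩
      exact lt_of_le_of_ne (heI x (hφ.tsupport_subset h')) fun h'' =>
        heI' (h'' ▸ hφ.tsupport_subset h')
    have hz : ∀ x, x ∉ tsupport φ → φ x = 0 := fun x => image_eq_zero_of_notMem_tsupport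
    have hz' : ∀ x, x ∉ tsupport φ → deriv φ x = 0 := fun x hx =>
      image_eq_zero_of_notMem_tsupport fun h' => hx ((closure_minimal support_deriv_subset
        (isClosed_tsupport φ)) h')
    have hsubI : Ioc e b' ⊆ I := fun x hx => by
      rcases hx.2.lt_or_eq with h' | h'
      · exact hsub _ hb' ⟨hx.1, h'⟩
      · exact h' ▸ hb'
    rw [integral_add ((hg b' hb').mul_continuousOn_of_subset hφ.continuous.continuousOn
      measurableSet_Ioc isCompact_Icc Ioc_subset_Icc_self) (hi2.mono_set hsubI)] at key
    rw [htail (fun x => g x * φ x) (fun x hx => by simp [hz x hx]),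
      htail (fun x => G x * deriv φ x) (fun x hx => by simp [hz' x hx])]
    linarith)
  refine ⟨c, ?_⟩
  filter_upwards [hc'] with x hx
  simp only [G] at hx
  linarith

/-! ### The space H¹ on the half-line. -/

/-- `p ∈ H¹(0, ∞)` with derivative `p'`; `p` is the continuous representative. -/
structure HalfLineH1 (p p' : ℝ → ℝ) : Prop where
  memLp : MemLp p 2 (volume.restrict (Ioi 0))
  memLp_deriv : MemLp p' 2 (volume.restrict (Ioi 0))
  eq_primitive : ∀ x, 0 ≤ x → p x = p 0 + ∫ t in (0 : ℝ)..x, p' t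

theorem MeasureTheory.MemLp.integrableOn_Ioc_of_Ioi {g : ℝ → ℝ}
    (hg : MemLp g 2 (volume.restrict (Ioi 0))) (x : ℝ) : IntegrableOn g (Ioc 0 x) := by
  have h := (hg.restrict (Ioc 0 x))
  rw [Measure.restrict_restrict measurableSet_Ioc, inter_eq_left.2 Ioc_subset_Ioi_self] at h
  exact h.integrable (by norm_num)

theorem MeasureTheory.MemLp.intervalIntegrable_of_Ioi {g : ℝ → ℝ}
    (hg : MemLp g 2 (volume.restrict (Ioi 0))) {x : ℝ} (hx : 0 ≤ x) :
    IntervalIntegrable g volume 0 x :=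
  (intervalIntegrable_iff_integrableOn_Ioc_of_le hx).2 (hg.integrableOn_Ioc_of_Ioi x)

/-- An integrable function with integrable derivative vanishes at infinity. -/
theorem integral_Ioi_eq_neg_of_eq_primitive {h k : ℝ → ℝ} (hh : IntegrableOn h (Ioi 0))
    (hk : IntegrableOn k (Ioi 0)) (H : ∀ x, 0 ≤ x → h x = h 0 + ∫ t in (0 : ℝ)..x, k t) :
    Tendsto h atTop (𝓝 0) ∧ ∫ x in Ioi 0, k x = - h 0 := by
  have h1 : Tendsto h atTop (𝓝 (h 0 + ∫ x in Ioi 0, k x)) := by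
    refine ((intervalIntegral_tendsto_integral_Ioi 0 hk tendsto_id).const_add (h 0)).congr' ?_
    filter_upwards [eventually_ge_atTop 0] with x hx using (H x hx).symm
  -- The limit exists because k is integrable; it is zero because neighbourhoods of infinity have
  -- infinite measure and h is integrable.
  have h2 : h 0 + ∫ x in Ioi 0, k x = 0 := by
    refine IntegrableAtFilter.eq_zero_of_tendsto (μ := volume)
      ⟨Ioi 0, Ioi_mem_atTop _, hh⟩ ?_ h1
    intro s hs
    rcases mem_atTop_sets.1 hs with ⟨b, hb⟩
    rw [← top_le_iff, ← Real.volume_Ici (a := b)]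
    exact measure_mono hb
  exact ⟨h2 ▸ h1, by linarith⟩

namespace HalfLineH1

variable {p p' q q' : ℝ → ℝ}

theorem integrableOn_mul (hp : MemLp p 2 (volume.restrict (Ioi 0)))
    (hq : MemLp q 2 (volume.restrict (Ioi 0))) : IntegrableOn (fun x => p x * q x) (Ioi 0) :=
  hp.integrable_mul hq

/-- A product of two H¹ functions and its derivative are both integrable, so the only boundary term
is the one at 0. -/
theorem mul_aux (hp : HalfLineH1 p p') (hq : HalfLineH1 q q') :
    Tendsto (fun x => p x * q x) atTop (𝓝 0) ∧
      ∫ x in Ioi 0, (p' x * q x + p x * q' x) = - (p 0 * q 0) := by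
  refine integral_Ioi_eq_neg_of_eq_primitive (integrableOn_mul hp.memLp hq.memLp)
    ((integrableOn_mul hp.memLp_deriv hq.memLp).add (integrableOn_mul hp.memLp hq.memLp_deriv)) ?_
  intro x hx
  rw [integral_primitive_mul_primitive (hp.memLp_deriv.intervalIntegrable_of_Ioi hx)
    (hq.memLp_deriv.intervalIntegrable_of_Ioi hx)]
  · ring
  · intro y hy
    rw [uIcc_of_le hx] at hy
    exact hp.eq_primitive y hy.1
  · intro y hy
    rw [uIcc_of_le hx] at hy
    exact hq.eq_primitive y hy.1

/-- Integration by parts on the half-line. -/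
theorem integral_deriv_mul (hp : HalfLineH1 p p') (hq : HalfLineH1 q q') :
    ∫ x in Ioi 0, p' x * q x = - (p 0 * q 0) - ∫ x in Ioi 0, p x * q' x := by
  have := (hp.mul_aux hq).2
  rw [integral_add (integrableOn_mul hp.memLp_deriv hq.memLp)
    (integrableOn_mul hp.memLp hq.memLp_deriv)] at this
  linarith

theorem tendsto_zero (hp : HalfLineH1 p p') : Tendsto p atTop (𝓝 0) := by
  have h := (hp.mul_aux hp).1
  have h2 := h.sqrt
  simp only [Real.sqrt_mul_self_eq_abs, Real.sqrt_zero] at h2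
  exact (tendsto_zero_iff_abs_tendsto_zero _).2 h2

theorem continuousOn (hp : HalfLineH1 p p') : ContinuousOn p (Ici 0) := by
  have : ContinuousOn (fun x => p 0 + ∫ t in (0 : ℝ)..x, p' t) (Ici 0) := by
    refine continuousOn_const.add fun x hx => ?_
    have hx' : (0 : ℝ) ≤ x + 1 := le_add_of_nonneg_of_le hx zero_le_one
    have hc := intervalIntegral.continuousOn_primitive_interval'
      (hp.memLp_deriv.intervalIntegrable_of_Ioi hx') left_mem_uIcc
    rw [uIcc_of_le hx'] at hc
    refine (hc x ⟨hx, by linarith⟩).mono_of_mem_nhdsWithin ?_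
    rw [← Ici_inter_Iic]
    exact inter_mem self_mem_nhdsWithin (mem_nhdsWithin_of_mem_nhds (Iic_mem_nhds (by linarith)))
  exact this.congr fun x hx => hp.eq_primitive x hx

/-- Transfers boundary values, which are prescribed for some continuous representative, to p. -/
theorem eqOn (hp : HalfLineH1 p p') {w : ℝ → ℝ} (hw : ContinuousOn w (Ici 0))
    (h : ∀ᵐ x ∂volume.restrict (Ioi 0), p x = w x) : EqOn p w (Ici 0) := by
  refine Measure.eqOn_of_ae_eq (μ := volume) ?_ hp.continuousOn hw ?_
  · rw [← restrict_Ioi_eq_restrict_Ici]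
    exact h
  · rw [interior_Ici, closure_Ioi]

theorem exists_of_weakDeriv {f g : ℝ → ℝ} (hf : MemLp f 2 (volume.restrict (Ioi 0)))
    (hg : MemLp g 2 (volume.restrict (Ioi 0)))
    (H : ∀ φ, IsTest (Ioi 0) φ → ∫ x in Ioi 0, f x * deriv φ x = - ∫ x in Ioi 0, g x * φ x) :
    ∃ p, HalfLineH1 p g ∧ ∀ᵐ x ∂volume.restrict (Ioi 0), p x = f x := by
  have hloc : LocallyIntegrableOn f (Ioi 0) :=
    locallyIntegrableOn_of_locallyIntegrable_restrict (hf.locallyIntegrable (by norm_num))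
  obtain ⟨c, hc⟩ := exists_ae_eq_primitive isOpen_Ioi ordConnected_Ioi (e := 0)
    (fun x hx => le_of_lt hx) hloc (fun x _ => hg.integrableOn_Ioc_of_Ioi x) H
    (fun x _ => Ioo_subset_Ioi_self)
  have hc' : ∀ᵐ x ∂volume.restrict (Ioi 0), c + ∫ t in (0 : ℝ)..x, g t = f x :=
    hc.mono fun x hx => hx.symm
  exact ⟨fun x => c + ∫ t in (0 : ℝ)..x, g t,
    ⟨hf.ae_eq (hc'.mono fun x hx => hx.symm), hg, fun x _ => by simp⟩, hc'⟩

/-- Allows the derivative to be replaced by its own continuous representative, so that successive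
derivatives form a chain. -/
theorem congr_deriv (hp : HalfLineH1 p p') (h : ∀ᵐ x ∂volume.restrict (Ioi 0), q' x = p' x) :
    HalfLineH1 p q' := by
  refine ⟨hp.memLp, hp.memLp_deriv.ae_eq (h.mono fun x hx => hx.symm), fun x hx => ?_⟩
  rw [hp.eq_primitive x hx]
  congr 1
  apply intervalIntegral.integral_congr_ae
  rw [uIoc_of_le hx]
  filter_upwards [(ae_restrict_iff' measurableSet_Ioi).1 h] with t ht ht'
  exact (ht ht'.1).symm

end HalfLineH1

/-! ### The energy of one sine mode. -/

/-- The energy inequality for a single sine mode of frequency `√lam`. -/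
theorem energy_nonneg_of_weakDeriv {f : ℕ → ℝ → ℝ} {lam γ c : ℝ} (hlam : 0 ≤ lam) (hγ : γ ≤ 0)
    (hc : c ≤ lam ^ 2 + |γ| * lam)
    (hf : ∀ i ≤ 5, MemLp (f i) 2 (volume.restrict (Ioi 0)))
    (H : ∀ i < 5, ∀ φ, IsTest (Ioi 0) φ →
      ∫ x in Ioi 0, f i x * deriv φ x = - ∫ x in Ioi 0, f (i + 1) x * φ x)
    (h0 : ∃ w, ContinuousOn w (Ici 0) ∧ (∀ᵐ x ∂volume.restrict (Ioi 0), w x = f 0 x) ∧ w 0 = 0)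
    (h1 : ∃ w, ContinuousOn w (Ici 0) ∧ (∀ᵐ x ∂volume.restrict (Ioi 0), w x = f 1 x) ∧ w 0 = 0) :
    0 ≤ ∫ x in Ioi 0, ((f 4 x - 2 * lam * f 2 x + lam ^ 2 * f 0 x) + γ * (f 2 x - lam * f 0 x)
      + (f 3 x - lam * f 1 x) - f 5 x - c * f 0 x) * f 0 x := by
  have hex : ∀ i < 5, ∃ p, HalfLineH1 p (f (i + 1)) ∧
      ∀ᵐ x ∂volume.restrict (Ioi 0), p x = f i x := fun i hi =>
    HalfLineH1.exists_of_weakDeriv (hf i hi.le) (hf (i + 1) hi) (H i hi)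
  obtain ⟨g0, H0, e0⟩ := hex 0 (by norm_num)
  obtain ⟨g1, H1, e1⟩ := hex 1 (by norm_num)
  obtain ⟨g2, H2, e2⟩ := hex 2 (by norm_num)
  obtain ⟨g3, H3, e3⟩ := hex 3 (by norm_num)
  obtain ⟨g4, H4, e4⟩ := hex 4 (by norm_num)
  -- Now g0, …, g4 are continuous and each is the derivative of the preceding one; f 5 is only in
  -- L².
  replace H0 := H0.congr_deriv e1
  replace H1 := H1.congr_deriv e2
  replace H2 := H2.congr_deriv e3
  replace H3 := H3.congr_deriv e4
  simp only [Nat.reduceAdd] at H4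
  have z0 : g0 0 = 0 := by
    obtain ⟨w, hw, hwf, hw0⟩ := h0
    exact (H0.eqOn hw (by filter_upwards [e0, hwf] with x h h' using h.trans h'.symm)
      (mem_Ici.2 le_rfl)).trans hw0
  have z1 : g1 0 = 0 := by
    obtain ⟨w, hw, hwf, hw0⟩ := h1
    exact (H1.eqOn hw (by filter_upwards [e1, hwf] with x h h' using h.trans h'.symm)
      (mem_Ici.2 le_rfl)).trans hw0
  have key : ∫ x in Ioi 0, ((f 4 x - 2 * lam * f 2 x + lam ^ 2 * f 0 x)
      + γ * (f 2 x - lam * f 0 x) + (f 3 x - lam * f 1 x) - f 5 x - c * f 0 x) * f 0 x =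
      ∫ x in Ioi 0, (g4 x * g0 x + (γ - 2 * lam) * (g2 x * g0 x)
        + (lam ^ 2 - γ * lam - c) * (g0 x * g0 x) + g3 x * g0 x - lam * (g1 x * g0 x)
        - f 5 x * g0 x) := by
    apply integral_congr_ae
    filter_upwards [e0, e1, e2, e3, e4] with x h0 h1 h2 h3 h4
    rw [h0, h1, h2, h3, h4]
    ring
  have i40 := HalfLineH1.integrableOn_mul H4.memLp H0.memLp
  have i20 := (HalfLineH1.integrableOn_mul H2.memLp H0.memLp).const_mul (γ - 2 * lam)
  have i00 := (HalfLineH1.integrableOn_mul H0.memLp H0.memLp).const_mul (lam ^ 2 - γ * lam - c)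
  have i30 := HalfLineH1.integrableOn_mul H3.memLp H0.memLp
  have i10 := (HalfLineH1.integrableOn_mul H1.memLp H0.memLp).const_mul lam
  have i50 := HalfLineH1.integrableOn_mul H4.memLp_deriv H0.memLp
  have j2 := Integrable.fun_add i40 i20
  have j3 := Integrable.fun_add j2 i00
  have j4 := Integrable.fun_add j3 i30
  have j5 : Integrable (fun x => g4 x * g0 x + (γ - 2 * lam) * (g2 x * g0 x)
      + (lam ^ 2 - γ * lam - c) * (g0 x * g0 x) + g3 x * g0 x - lam * (g1 x * g0 x))
      (volume.restrict (Ioi 0)) := j4.sub i10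
  rw [key, integral_sub j5 i50, integral_sub j4 i10, integral_add j3 i30, integral_add j2 i00,
    integral_add i40 i20]
  simp only [integral_const_mul]
  have a50 := H4.integral_deriv_mul H0
  have a41 := H3.integral_deriv_mul H1
  have a40 := H3.integral_deriv_mul H0
  have a31 := H2.integral_deriv_mul H1
  have a32 := H2.integral_deriv_mul H2
  have a30 := H2.integral_deriv_mul H0
  have a21 := H1.integral_deriv_mul H1
  have a20 := H1.integral_deriv_mul H0
  have a10 := H0.integral_deriv_mul H0
  rw [z0] at a50 a40 a30 a20 a10
  rw [z1] at a41 a31 a21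
  have c23 : ∫ x in Ioi 0, g2 x * g3 x = ∫ x in Ioi 0, g3 x * g2 x := by simp_rw [mul_comm]
  have c12 : ∫ x in Ioi 0, g1 x * g2 x = ∫ x in Ioi 0, g2 x * g1 x := by simp_rw [mul_comm]
  have c01 : ∫ x in Ioi 0, g0 x * g1 x = ∫ x in Ioi 0, g1 x * g0 x := by simp_rw [mul_comm]
  rw [c23] at a32
  rw [c12] at a21
  rw [c01] at a10
  have n2 : 0 ≤ ∫ x in Ioi 0, g2 x * g2 x := integral_nonneg fun x => mul_self_nonneg _
  have n1 : 0 ≤ ∫ x in Ioi 0, g1 x * g1 x := integral_nonneg fun x => mul_self_nonneg _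
  have n0 : 0 ≤ ∫ x in Ioi 0, g0 x * g0 x := integral_nonneg fun x => mul_self_nonneg _
  rw [abs_of_nonpos hγ] at hc
  have hcc : 0 ≤ lam ^ 2 - γ * lam - c := by linarith
  have m1 : 0 ≤ (2 * lam - γ) * ∫ x in Ioi 0, g1 x * g1 x := mul_nonneg (by linarith) n1
  have m0 := mul_nonneg hcc n0
  have s10 : ∫ x in Ioi 0, g1 x * g0 x = 0 := by linarith
  have s30 : ∫ x in Ioi 0, g3 x * g0 x = 0 := by linarith
  -- Moving two derivatives gives ∫g3·g2, an exact derivative, so the integral equals −g2(0)²/2.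
  have s50 : ∫ x in Ioi 0, f 5 x * g0 x ≤ 0 := by nlinarith [sq_nonneg (g2 0)]
  have s20 : ∫ x in Ioi 0, g2 x * g0 x = - ∫ x in Ioi 0, g1 x * g1 x := by linarith
  have s40 : ∫ x in Ioi 0, g4 x * g0 x = ∫ x in Ioi 0, g2 x * g2 x := by linarith
  rw [s10, s30, s20, s40]
  nlinarith

/-! ### Sine series on (0, B). -/

/-- The sine modes on `(0, B)`, indexed by `ℤ`. -/
noncomputable def sineMode (B : ℝ) (n : ℤ) (y : ℝ) : ℝ := Real.sin (n * Real.pi / B * y)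

theorem continuous_sineMode (B : ℝ) (n : ℤ) : Continuous (sineMode B n) := by
  unfold sineMode
  fun_prop

theorem abs_sineMode_le_one (B : ℝ) (n : ℤ) (y : ℝ) : |sineMode B n y| ≤ 1 :=
  Real.abs_sin_le_one _

/-- Parseval's identity for sine series. -/
theorem hasSum_sq_integral_mul_sineMode {B : ℝ} (hB : 0 < B) {h : ℝ → ℝ}
    (hh : MemLp h 2 (volume.restrict (Ioo 0 B))) :
    HasSum (fun n : ℤ => (∫ y in Ioo 0 B, h y * sineMode B n y) ^ 2)
      (B * ∫ y in Ioo 0 B, h y ^ 2) := by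
  let k : ℝ → ℝ := (Ioo 0 B).indicator h
  have hk : MemLp k 2 volume := (memLp_indicator_iff_restrict measurableSet_Ioo).2 hh
  have hkn : MemLp (fun y => k (-y)) 2 volume :=
    hk.comp_measurePreserving (Measure.measurePreserving_neg volume)
  -- The odd extension of h to (−B, B): the cosine parts of its Fourier coefficients vanish, and the
  -- n-th coefficient has modulus 1/B times that of the n-th sine integral. Modes n and −n are both
  -- counted, whence the constant B instead of B/2.
  let H : ℝ → ℂ := fun y => ((k y - k (-y) : ℝ) : ℂ)
  have hH : MemLp H 2 (volume.restrict (Ioc (-B) B)) := ((hk.sub hkn).ofReal (K := ℂ)).restrict _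
  have hab : -B < B := by linarith
  have key := hasSum_sq_fourierCoeffOn hab hH
  have hkI : ∀ c : ℝ → ℝ, ∫ y in (-B)..B, k y * c y = ∫ y in Ioo 0 B, h y * c y := by
    intro c
    rw [intervalIntegral.integral_of_le hab.le,
      show (fun y => k y * c y) = (Ioo 0 B).indicator (fun y => h y * c y) from
        funext fun y => by simp only [k, indicator_mul_left],
      setIntegral_indicator measurableSet_Ioo, inter_eq_right.2]
    exact fun y hy => ⟨by linarith [hy.1], hy.2.le⟩
  have hii : ∀ {r : ℝ → ℝ}, MemLp r 2 volume → IntervalIntegrable r volume (-B) B := fun hr =>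
    ⟨(hr.restrict _).integrable (by norm_num), (hr.restrict _).integrable (by norm_num)⟩
  have hint : ∀ c : ℝ → ℝ, Continuous c → IntervalIntegrable (fun y => k y * c y) volume (-B) B :=
    fun c hc => (hii hk).mul_continuousOn
      hc.continuousOn
  have hintn : ∀ c : ℝ → ℝ, Continuous c →
      IntervalIntegrable (fun y => k (-y) * c y) volume (-B) B :=
    fun c hc => (hii hkn).mul_continuousOn
      hc.continuousOn
  have hneg : ∀ c : ℝ → ℝ, ∫ y in (-B)..B, k (-y) * c y = ∫ y in (-B)..B, k y * c (-y) := by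
    intro c
    have := intervalIntegral.integral_comp_neg (a := -B) (b := B) (fun y => k y * c (-y))
    simpa using this
  have hcoeff : ∀ n : ℤ, ‖fourierCoeffOn hab H n‖ ^ 2 =
      (B ^ 2)⁻¹ * (∫ y in Ioo 0 B, h y * sineMode B n y) ^ 2 := by
    intro n
    rw [fourierCoeffOn_eq_integral]
    have e1 : ∀ y : ℝ, fourier (-n) (y : AddCircle (B - -B)) • H y =
        (((k y - k (-y)) * Real.cos (n * Real.pi / B * y) : ℝ) : ℂ)
          - Complex.I * (((k y - k (-y)) * sineMode B n y : ℝ) : ℂ) := by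
      intro y
      rw [fourier_coe_apply]
      have : 2 * (Real.pi : ℂ) * Complex.I * ((-n : ℤ) : ℂ) * (y : ℂ) / ((B - -B : ℝ) : ℂ) =
          ((-(n * Real.pi / B * y) : ℝ) : ℂ) * Complex.I := by
        have : (B : ℂ) ≠ 0 := by exact_mod_cast hB.ne'
        push_cast
        field_simp
        ring
      rw [this, Complex.exp_mul_I, ← Complex.ofReal_cos, ← Complex.ofReal_sin, Real.cos_neg,
        Real.sin_neg]
      simp only [H, sineMode, smul_eq_mul]
      push_cast
      ring
    have c1 : Continuous fun y => Real.cos (n * Real.pi / B * y) := by fun_prop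
    have c2 := continuous_sineMode B n
    have i1 : IntervalIntegrable
        (fun y => (k y - k (-y)) * Real.cos (n * Real.pi / B * y)) volume (-B) B := by
      simpa only [sub_mul] using (hint _ c1).sub (hintn _ c1)
    have i2 : IntervalIntegrable
        (fun y => (k y - k (-y)) * sineMode B n y) volume (-B) B := by
      simpa only [sub_mul] using (hint _ c2).sub (hintn _ c2)
    have v1 : ∫ y in (-B)..B, (k y - k (-y)) * Real.cos (n * Real.pi / B * y) = 0 := by
      simp only [sub_mul]
      rw [intervalIntegral.integral_sub (hint _ c1) (hintn _ c1),
        hneg fun y => Real.cos (n * Real.pi / B * y)]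
      simp
    have v2 : ∫ y in (-B)..B, (k y - k (-y)) * sineMode B n y =
        2 * ∫ y in Ioo 0 B, h y * sineMode B n y := by
      simp only [sub_mul]
      rw [intervalIntegral.integral_sub (hint _ c2) (hintn _ c2), hneg, ← hkI]
      have : ∀ y, sineMode B n (-y) = - sineMode B n y := fun y => by
        simp [sineMode]
      simp only [this, mul_neg, intervalIntegral.integral_neg]
      ring
    have hofReal : ∀ {r : ℝ → ℝ}, IntervalIntegrable r volume (-B) B →
        IntervalIntegrable (fun y => (r y : ℂ)) volume (-B) B := fun hr =>
      ⟨Integrable.ofReal hr.1, Integrable.ofReal hr.2⟩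
    simp_rw [e1]
    rw [intervalIntegral.integral_sub (hofReal i1) ((hofReal i2).const_mul _),
      intervalIntegral.integral_const_mul, intervalIntegral.integral_ofReal,
      intervalIntegral.integral_ofReal, v1, v2, norm_smul]
    simp only [Complex.ofReal_zero, zero_sub, norm_neg, norm_mul, Complex.norm_I, one_mul,
      Complex.norm_real, Real.norm_eq_abs, mul_pow, sq_abs]
    field_simp
    ring
  have hnorm : ∫ y in (-B)..B, ‖H y‖ ^ 2 = 2 * ∫ y in Ioo 0 B, h y ^ 2 := by
    have e2 : ∀ y, ‖H y‖ ^ 2 = k y * k y + k (-y) * k (-y) := by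
      intro y
      -- The two halves of the odd extension have disjoint supports.
      have hz : k y * k (-y) = 0 := by
        by_cases hy : y ∈ Ioo 0 B
        · have : -y ∉ Ioo 0 B := fun h' => by linarith [h'.1, hy.1]
          simp [k, indicator_of_notMem this]
        · simp [k, indicator_of_notMem hy]
      simp only [H, Complex.norm_real, Real.norm_eq_abs, sq_abs]
      linear_combination -2 * hz
    simp_rw [e2]
    have i3 : IntervalIntegrable (fun y => k y * k y) volume (-B) B :=
      (hk.integrable_mul hk).intervalIntegrable
    have i4 : IntervalIntegrable (fun y => k (-y) * k (-y)) volume (-B) B :=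
      (hkn.integrable_mul hkn).intervalIntegrable
    rw [intervalIntegral.integral_add i3 i4, hneg fun y => k (-y)]
    simp only [neg_neg]
    rw [hkI k, two_mul]
    have : ∫ y in Ioo 0 B, h y * k y = ∫ y in Ioo 0 B, h y ^ 2 :=
      setIntegral_congr_fun measurableSet_Ioo fun y hy => by
        simp only [k, indicator_of_mem hy, sq]
    rw [this]
  rw [hnorm] at key
  simp_rw [hcoeff] at key
  have := key.mul_left (B ^ 2)
  convert! this using 1
  · funext n
    field_simp
  · rw [smul_eq_mul]
    field_simp
    ring

/-- Polarization of Parseval's identity. -/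
theorem hasSum_integral_mul_sineMode_mul {B : ℝ} (hB : 0 < B) {h k : ℝ → ℝ}
    (hh : MemLp h 2 (volume.restrict (Ioo 0 B))) (hk : MemLp k 2 (volume.restrict (Ioo 0 B))) :
    HasSum (fun n : ℤ => (∫ y in Ioo 0 B, h y * sineMode B n y) *
      ∫ y in Ioo 0 B, k y * sineMode B n y) (B * ∫ y in Ioo 0 B, h y * k y) := by
  have H1 := hasSum_sq_integral_mul_sineMode hB (hh.add hk)
  have H2 := hasSum_sq_integral_mul_sineMode hB hh
  have H3 := hasSum_sq_integral_mul_sineMode hB hk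
  have hi : ∀ {r : ℝ → ℝ}, MemLp r 2 (volume.restrict (Ioo 0 B)) → ∀ n,
      IntegrableOn (fun y => r y * sineMode B n y) (Ioo 0 B) := fun hr n =>
    (hr.integrable (by norm_num)).mul_bdd (c := 1) (continuous_sineMode B n).aestronglyMeasurable
      (Eventually.of_forall fun y => abs_sineMode_le_one B n y)
  have e : ∀ n, ∫ y in Ioo 0 B, (h + k) y * sineMode B n y =
      (∫ y in Ioo 0 B, h y * sineMode B n y) + ∫ y in Ioo 0 B, k y * sineMode B n y := by
    intro n
    rw [← integral_add (hi hh n) (hi hk n)]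
    simp only [Pi.add_apply, add_mul]
  have e' : ∫ y in Ioo 0 B, (h + k) y ^ 2 = (∫ y in Ioo 0 B, h y ^ 2) + (∫ y in Ioo 0 B, k y ^ 2)
      + 2 * ∫ y in Ioo 0 B, h y * k y := by
    have j : IntegrableOn (fun y => h y * k y) (Ioo 0 B) := hh.integrable_mul hk
    rw [← integral_const_mul, ← integral_add hh.integrable_sq hk.integrable_sq,
      ← integral_add (Integrable.fun_add hh.integrable_sq hk.integrable_sq) (j.const_mul 2)]
    congr 1
    funext y
    simp only [Pi.add_apply]
    ring
  simp_rw [e] at H1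
  rw [e'] at H1
  convert! ((H1.sub H2).sub H3).mul_left (1 / 2) using 1
  · funext n
    ring
  · ring

/-! ### Moments of functions on a product and on the strip. -/

theorem MeasureTheory.MemLp.integrable_fun_mul {α : Type*} [MeasurableSpace α] {ν : Measure α}
    {g h : α → ℝ} (hg : MemLp g 2 ν) (hh : MemLp h 2 ν) : Integrable (fun x => g x * h x) ν :=
  hg.integrable_mul hh

/-- A weak Cauchy–Schwarz inequality, from the square of (C + 1)g − cη. The extra 1 keeps the
divisor positive when η = 0; the size of the constant is irrelevant for integrability of moments. -/
theorem sq_integral_mul_le {α : Type*} [MeasurableSpace α] {ν : Measure α} {g η : α → ℝ}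
    (hg : MemLp g 2 ν) (hη : MemLp η 2 ν) :
    (∫ y, g y * η y ∂ν) ^ 2 ≤ ((∫ y, η y ^ 2 ∂ν) + 1) * ∫ y, g y ^ 2 ∂ν := by
  set c := ∫ y, g y * η y ∂ν
  set C := ∫ y, η y ^ 2 ∂ν
  set A := ∫ y, g y ^ 2 ∂ν
  have hC : 0 ≤ C := integral_nonneg fun y => sq_nonneg _
  have hgη : Integrable (fun y => g y * η y) ν := hg.integrable_mul hη
  have h0 : 0 ≤ ∫ y, ((C + 1) * g y - c * η y) ^ 2 ∂ν := integral_nonneg fun y => sq_nonneg _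
  have e : ∀ y, ((C + 1) * g y - c * η y) ^ 2 =
      (C + 1) ^ 2 * g y ^ 2 - 2 * (C + 1) * c * (g y * η y) + c ^ 2 * η y ^ 2 := fun y => by ring
  have i1 := hg.integrable_sq.const_mul ((C + 1) ^ 2)
  have i2 := hgη.const_mul (2 * (C + 1) * c)
  have i3 := hη.integrable_sq.const_mul (c ^ 2)
  have i12 : Integrable (fun y => (C + 1) ^ 2 * g y ^ 2 - 2 * (C + 1) * c * (g y * η y)) ν :=
    i1.sub i2
  simp_rw [e] at h0
  rw [integral_add i12 i3, integral_sub i1 i2, integral_const_mul, integral_const_mul,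
    integral_const_mul] at h0
  change 0 ≤ (C + 1) ^ 2 * A - 2 * (C + 1) * c * c + c ^ 2 * C at h0
  have h1 : (C + 1) * c ^ 2 ≤ (C + 1) * ((C + 1) * A) := by nlinarith [sq_nonneg c]
  exact le_of_mul_le_mul_left h1 (by linarith)

theorem memLp_tensor {μ ν : Measure ℝ} {φ η : ℝ → ℝ} (hφ : MemLp φ 2 μ)
    (hη : MemLp η 2 ν) :
    MemLp (fun p : ℝ × ℝ => φ p.1 * η p.2) 2 (μ.prod ν) := by
  refine (memLp_two_iff_integrable_sq (hφ.1.comp_fst.mul hη.1.comp_snd)).2 ?_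
  simpa only [Pi.mul_apply, mul_pow] using hφ.integrable_sq.mul_prod hη.integrable_sq

section Moments

variable {μ ν : Measure ℝ} [SFinite μ] [SFinite ν] {F : ℝ × ℝ → ℝ} {φ η : ℝ → ℝ}

theorem MeasureTheory.MemLp.slice_ae (hF : MemLp F 2 (μ.prod ν)) :
    ∀ᵐ x ∂μ, MemLp (fun y => F (x, y)) 2 ν := by
  filter_upwards [hF.integrable_sq.prod_right_ae, hF.1.prodMk_left] with x h1 h2
  exact (memLp_two_iff_integrable_sq h2).2 h1

theorem MeasureTheory.MemLp.moment (hF : MemLp F 2 (μ.prod ν)) (hη : MemLp η 2 ν) :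
    MemLp (fun x => ∫ y, F (x, y) * η y ∂ν) 2 μ := by
  have hm : AEStronglyMeasurable (fun x => ∫ y, F (x, y) * η y ∂ν) μ :=
    (hF.1.mul hη.1.comp_snd).integral_prod_right'
  refine (memLp_two_iff_integrable_sq hm).2 ?_
  refine Integrable.mono' (hF.integrable_sq.integral_prod_left.const_mul
    ((∫ y, η y ^ 2 ∂ν) + 1)) (hm.pow 2) ?_
  filter_upwards [hF.slice_ae] with x hx
  rw [Real.norm_eq_abs, abs_of_nonneg (sq_nonneg _)]
  exact sq_integral_mul_le hx hη

theorem integral_tensor_eq_moment (hF : MemLp F 2 (μ.prod ν)) (hφ : MemLp φ 2 μ)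
    (hη : MemLp η 2 ν) :
    ∫ p, F p * (φ p.1 * η p.2) ∂(μ.prod ν) = ∫ x, (∫ y, F (x, y) * η y ∂ν) * φ x ∂μ := by
  rw [integral_prod _ (hF.integrable_fun_mul (memLp_tensor hφ hη))]
  congr 1
  funext x
  rw [← integral_mul_const]
  congr 1
  funext y
  ring

theorem MeasureTheory.MemLp.swap (hF : MemLp F 2 (μ.prod ν)) :
    MemLp (fun p : ℝ × ℝ => F p.swap) 2 (ν.prod μ) :=
  hF.comp_measurePreserving Measure.measurePreserving_swap

theorem integral_tensor_eq_moment' (hF : MemLp F 2 (μ.prod ν)) (hφ : MemLp φ 2 μ)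
    (hη : MemLp η 2 ν) :
    ∫ p, F p * (φ p.1 * η p.2) ∂(μ.prod ν) = ∫ y, (∫ x, F (x, y) * φ x ∂μ) * η y ∂ν := by
  refine Eq.trans ?_ (integral_tensor_eq_moment (F := fun p : ℝ × ℝ => F p.swap) hF.swap hη hφ)
  rw [← integral_prod_swap]
  congr 1
  funext p
  simp only [Prod.fst_swap, Prod.snd_swap]
  ring

end Moments

theorem stripMeasure_eq_prod (B : ℝ) :
    stripMeasure B = (volume.restrict (Ioi 0)).prod (volume.restrict (Ioo 0 B)) := by
  rw [Measure.prod_restrict]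
  rfl

theorem IsTest.memLp_self {I : Set ℝ} {φ : ℝ → ℝ} (h : IsTest I φ) :
    MemLp φ 2 (volume.restrict I) := h.memLp I

theorem memLp_sineMode (B : ℝ) (n : ℤ) : MemLp (sineMode B n) 2 (volume.restrict (Ioo 0 B)) :=
  MemLp.of_bound (continuous_sineMode B n).aestronglyMeasurable 1
    (Eventually.of_forall fun y => abs_sineMode_le_one B n y)

/-- `∫_D f(x, y) φ(x) η(y) dx dy`. -/
noncomputable def tensorPairing (B : ℝ) (f : ℝ × ℝ → ℝ) (φ η : ℝ → ℝ) : ℝ :=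
  ∫ p in halfStrip B, f p * (φ p.1 * η p.2)

/-- `∫_0^B f(x, y) η(y) dy`. -/
noncomputable def yMoment (B : ℝ) (f : ℝ × ℝ → ℝ) (η : ℝ → ℝ) (x : ℝ) : ℝ :=
  ∫ y in Ioo 0 B, f (x, y) * η y

/-- `∫_0^∞ f(x, y) φ(x) dx`. -/
noncomputable def xMoment (f : ℝ × ℝ → ℝ) (φ : ℝ → ℝ) (y : ℝ) : ℝ :=
  ∫ x in Ioi 0, f (x, y) * φ x

section Strip

variable {B : ℝ} {f g : ℝ × ℝ → ℝ} {φ φ' η : ℝ → ℝ}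

theorem memLp_yMoment (hf : MemLp f 2 (stripMeasure B))
    (hη : MemLp η 2 (volume.restrict (Ioo 0 B))) :
    MemLp (yMoment B f η) 2 (volume.restrict (Ioi 0)) := by
  rw [stripMeasure_eq_prod] at hf
  exact hf.moment hη

theorem memLp_xMoment (hf : MemLp f 2 (stripMeasure B))
    (hφ : MemLp φ 2 (volume.restrict (Ioi 0))) :
    MemLp (xMoment f φ) 2 (volume.restrict (Ioo 0 B)) := by
  rw [stripMeasure_eq_prod] at hf
  exact hf.swap.moment hφ

theorem tensorPairing_eq_yMoment (hf : MemLp f 2 (stripMeasure B))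
    (hφ : MemLp φ 2 (volume.restrict (Ioi 0))) (hη : MemLp η 2 (volume.restrict (Ioo 0 B))) :
    tensorPairing B f φ η = ∫ x in Ioi 0, yMoment B f η x * φ x := by
  rw [stripMeasure_eq_prod] at hf
  have := integral_tensor_eq_moment hf hφ hη
  rw [← stripMeasure_eq_prod] at this
  exact this

theorem tensorPairing_eq_xMoment (hf : MemLp f 2 (stripMeasure B))
    (hφ : MemLp φ 2 (volume.restrict (Ioi 0))) (hη : MemLp η 2 (volume.restrict (Ioo 0 B))) :
    tensorPairing B f φ η = ∫ y in Ioo 0 B, xMoment f φ y * η y := by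
  rw [stripMeasure_eq_prod] at hf
  have := integral_tensor_eq_moment' hf hφ hη
  rw [← stripMeasure_eq_prod] at this
  exact this

/-- The fundamental lemma of the calculus of variations for `L²` functions. -/
theorem ae_eq_of_forall_isTest {I : Set ℝ} (hI : IsOpen I) {h k : ℝ → ℝ} {s : ℝ}
    (hh : MemLp h 2 (volume.restrict I)) (hk : MemLp k 2 (volume.restrict I))
    (H : ∀ φ, IsTest I φ → ∫ x in I, h x * φ x = s * ∫ x in I, k x * φ x) :
    ∀ᵐ x ∂volume.restrict I, h x = s * k x := by
  have hl : ∀ {r : ℝ → ℝ}, MemLp r 2 (volume.restrict I) → LocallyIntegrableOn r I := fun hr =>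
    locallyIntegrableOn_of_locallyIntegrable_restrict (hr.locallyIntegrable (by norm_num))
  have := hI.ae_eq_zero_of_integral_contDiff_smul_eq_zero (μ := volume)
    (f := fun x => h x - s * k x) ((hl hh).sub (hl (hk.const_mul s))) ?_
  · rw [ae_restrict_iff' hI.measurableSet]
    filter_upwards [this] with x hx hxI
    linarith [hx hxI]
  intro φ h1 h2 h3
  have hφ : IsTest I φ := ⟨h1, h2, h3⟩
  have e := H φ hφ
  rw [hφ.setIntegral_mul, hφ.setIntegral_mul] at e
  have e' : ∀ x, φ x • (h x - s * k x) = φ x * h x - s * (φ x * k x) := fun x => by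
    rw [smul_eq_mul]; ring
  simp_rw [e']
  rw [integral_sub (hφ.integrable_mul (hl hh)) ((hφ.integrable_mul (hl hk)).const_mul s),
    integral_const_mul]
  simp_rw [mul_comm (φ _)]
  rw [e, sub_self]

/-- An identity between pairings with test functions in `y` extends to all `η ∈ L²(0, B)`. -/
theorem tensorPairing_eq_of_forall_isTest {s : ℝ} (hf : MemLp f 2 (stripMeasure B))
    (hg : MemLp g 2 (stripMeasure B)) (hφ : MemLp φ 2 (volume.restrict (Ioi 0)))
    (hφ' : MemLp φ' 2 (volume.restrict (Ioi 0)))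
    (H : ∀ η, IsTest (Ioo 0 B) η → tensorPairing B f φ η = s * tensorPairing B g φ' η)
    (hη : MemLp η 2 (volume.restrict (Ioo 0 B))) :
    tensorPairing B f φ η = s * tensorPairing B g φ' η := by
  -- With the x-factors fixed, the identity says that two L² functions of y agree as distributions,
  -- hence almost everywhere. This admits the sine modes, which are not compactly supported in (0,
  -- B).
  have := ae_eq_of_forall_isTest isOpen_Ioo (memLp_xMoment hf hφ) (memLp_xMoment hg hφ')
    (s := s) (fun ψ hψ => by
      rw [← tensorPairing_eq_xMoment hf hφ hψ.memLp_self,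
        ← tensorPairing_eq_xMoment hg hφ' hψ.memLp_self]
      exact H ψ hψ)
  rw [tensorPairing_eq_xMoment hf hφ hη, tensorPairing_eq_xMoment hg hφ' hη,
    ← integral_const_mul]
  apply integral_congr_ae
  filter_upwards [this] with y hy
  rw [hy]
  ring

end Strip

/-! ### Weak derivatives tested against products. -/

theorem dX_tensor {φ η : ℝ → ℝ} (hφ : Differentiable ℝ φ) (hη : Differentiable ℝ η) :
    dX (fun p => φ p.1 * η p.2) = fun p => deriv φ p.1 * η p.2 := by
  funext p
  have h1 : HasFDerivAt (fun p : ℝ × ℝ => φ p.1) _ p :=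
    (hφ p.1).hasDerivAt.hasFDerivAt.comp p hasFDerivAt_fst
  have h2 : HasFDerivAt (fun p : ℝ × ℝ => η p.2) _ p :=
    (hη p.2).hasDerivAt.hasFDerivAt.comp p hasFDerivAt_snd
  have h := (h1.mul h2).fderiv
  simp only [Pi.mul_def] at h
  simp [dX, h, mul_comm]

theorem dY_tensor {φ η : ℝ → ℝ} (hφ : Differentiable ℝ φ) (hη : Differentiable ℝ η) :
    dY (fun p => φ p.1 * η p.2) = fun p => φ p.1 * deriv η p.2 := by
  funext p
  have h1 : HasFDerivAt (fun p : ℝ × ℝ => φ p.1) _ p :=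
    (hφ p.1).hasDerivAt.hasFDerivAt.comp p hasFDerivAt_fst
  have h2 : HasFDerivAt (fun p : ℝ × ℝ => η p.2) _ p :=
    (hη p.2).hasDerivAt.hasFDerivAt.comp p hasFDerivAt_snd
  have h := (h1.mul h2).fderiv
  simp only [Pi.mul_def] at h
  simp [dY, h]

theorem iterate_dX_iterate_dY_tensor {I J : Set ℝ} {φ η : ℝ → ℝ} (hφ : IsTest I φ)
    (hη : IsTest J η) (i j : ℕ) :
    dX^[i] (dY^[j] (fun p => φ p.1 * η p.2)) =
      fun p => deriv^[i] φ p.1 * deriv^[j] η p.2 := by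
  have hy : dY^[j] (fun p => φ p.1 * η p.2) = fun p => φ p.1 * deriv^[j] η p.2 := by
    induction j generalizing η with
    | zero => rfl
    | succ j ih =>
      rw [Function.iterate_succ_apply, dY_tensor hφ.differentiable hη.differentiable,
        ih hη.deriv, Function.iterate_succ_apply]
  have hx : ∀ {ζ : ℝ → ℝ}, IsTest J ζ →
      dX^[i] (fun p => φ p.1 * ζ p.2) = fun p => deriv^[i] φ p.1 * ζ p.2 := by
    intro ζ hζ
    clear hy
    induction i generalizing φ with
    | zero => rfl
    | succ i ih =>
      rw [Function.iterate_succ_apply, dX_tensor hφ.differentiable hζ.differentiable,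
        ih hφ.deriv, Function.iterate_succ_apply]
  rw [hy, hx (hη.iterate_deriv j)]

/-- Products φ(x)η(y) separate the variables and reduce derivatives on D to derivatives in one
variable. -/
theorem HasWeakDeriv.tensorPairing_eq {B : ℝ} {i j : ℕ} {f g : StripL2 B}
    (h : HasWeakDeriv B i j f g) {φ η : ℝ → ℝ} (hφ : IsTest (Ioi 0) φ)
    (hη : IsTest (Ioo 0 B) η) :
    tensorPairing B f (deriv^[i] φ) (deriv^[j] η) = (-1) ^ (i + j) * tensorPairing B g φ η := by
  have hsupp : tsupport (fun p : ℝ × ℝ => φ p.1 * η p.2) ⊆ tsupport φ ×ˢ tsupport η := by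
    refine closure_minimal (fun p hp => ?_) ((isClosed_tsupport φ).prod (isClosed_tsupport η))
    exact ⟨subset_tsupport _ (left_ne_zero_of_mul hp),
      subset_tsupport _ (right_ne_zero_of_mul hp)⟩
  have := h (fun p => φ p.1 * η p.2)
    ((hφ.contDiff.comp contDiff_fst).mul (hη.contDiff.comp contDiff_snd))
    ((IsCompact.prod hφ.compact hη.compact).of_isClosed_subset (isClosed_tsupport _) hsupp)
    (hsupp.trans (prod_mono hφ.tsupport_subset hη.tsupport_subset))
  rw [iterate_dX_iterate_dY_tensor hφ hη] at this
  exact this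

theorem HasWeakDeriv.eq_of_zero {B : ℝ} {f g : StripL2 B} (h : HasWeakDeriv B 0 0 f g) :
    f = g := by
  have hopen : IsOpen (halfStrip B) := isOpen_Ioi.prod isOpen_Ioo
  have hl : ∀ r : StripL2 B, LocallyIntegrableOn r (halfStrip B) := fun r =>
    locallyIntegrableOn_of_locallyIntegrable_restrict
      ((Lp.memLp r).locallyIntegrable (by norm_num))
  have key := hopen.ae_eq_zero_of_integral_contDiff_smul_eq_zero (μ := volume)
    (f := fun p => f p - g p) ((hl f).sub (hl g)) ?_
  · apply Lp.ext
    rw [EventuallyEq, ae_restrict_iff' hopen.measurableSet]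
    filter_upwards [key] with p hp hpI
    linarith [hp hpI]
  intro ψ h1 h2 h3
  have e := h ψ h1 h2 h3
  have hψ : MemLp ψ 2 (stripMeasure B) :=
    (h1.continuous.memLp_of_hasCompactSupport h2).restrict _
  rw [← setIntegral_eq_integral_of_forall_compl_eq_zero (s := halfStrip B) fun p hp => by
    rw [image_eq_zero_of_notMem_tsupport fun h' => hp (h3 h'), zero_smul]]
  have e' : ∀ p, ψ p • (f p - g p) = f p * ψ p - g p * ψ p := fun p => by
    rw [smul_eq_mul]; ring
  simp_rw [e']
  rw [integral_sub ((Lp.memLp f).integrable_fun_mul hψ) ((Lp.memLp g).integrable_fun_mul hψ)]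
  simpa [sub_eq_zero] using e

/-! ### Boundary values and sine coefficients of y-derivatives. -/

theorem closure_halfStrip {B : ℝ} (hB : 0 < B) : closure (halfStrip B) = Ici 0 ×ˢ Icc 0 B := by
  rw [halfStrip, closure_prod_eq, closure_Ioi, closure_Ioo hB.ne]

/-- The boundary representative extends to a continuous function on the plane. -/
theorem VanishesOn.exists_continuous {B : ℝ} (hB : 0 < B) {f : StripL2 B} {Γ : Set (ℝ × ℝ)}
    (h : VanishesOn B f Γ) (hΓ : Γ ⊆ Ici 0 ×ˢ Icc 0 B) :
    ∃ v : ℝ × ℝ → ℝ, Continuous v ∧ v =ᵐ[stripMeasure B] f ∧ ∀ p ∈ Γ, v p = 0 := by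
  obtain ⟨v, hv, hvf, hv0⟩ := h
  rw [closure_halfStrip hB] at hv
  -- The coordinatewise retraction of the plane onto the closed half-strip.
  let ρ : ℝ × ℝ → ℝ × ℝ := fun p => (max p.1 0, max 0 (min p.2 B))
  have hρ : Continuous ρ := by fun_prop
  have hmem : ∀ p, ρ p ∈ Ici (0 : ℝ) ×ˢ Icc 0 B := fun p =>
    ⟨mem_Ici.2 (le_max_right _ _), le_max_left _ _, max_le hB.le (min_le_right _ _)⟩
  have hid : ∀ p ∈ Ici (0 : ℝ) ×ˢ Icc 0 B, ρ p = p := fun p hp =>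
    Prod.ext (max_eq_left hp.1) (by
      show max 0 (min p.2 B) = p.2
      rw [min_eq_left hp.2.2, max_eq_right hp.2.1])
  refine ⟨v ∘ ρ, hv.comp_continuous hρ hmem, ?_, fun p hp => ?_⟩
  · have hms : MeasurableSet (halfStrip B) := (isOpen_Ioi.prod isOpen_Ioo).measurableSet
    filter_upwards [hvf, ae_restrict_mem hms] with p hp hpD
    rw [Function.comp_apply, hid p ⟨mem_Ici.2 (le_of_lt hpD.1), hpD.2.1.le, hpD.2.2.le⟩, hp]
  · rw [Function.comp_apply, hid p (hΓ hp), hv0 p hp]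

theorem ae_ae_of_ae_stripMeasure {B : ℝ} {P : ℝ × ℝ → Prop} (h : ∀ᵐ p ∂stripMeasure B, P p) :
    ∀ᵐ x ∂volume.restrict (Ioi (0 : ℝ)), ∀ᵐ y ∂volume.restrict (Ioo 0 B), P (x, y) := by
  rw [stripMeasure_eq_prod] at h
  exact Measure.ae_ae_of_ae_prod h

theorem ae_ae_of_ae_stripMeasure' {B : ℝ} {P : ℝ × ℝ → Prop} (h : ∀ᵐ p ∂stripMeasure B, P p) :
    ∀ᵐ y ∂volume.restrict (Ioo 0 B), ∀ᵐ x ∂volume.restrict (Ioi (0 : ℝ)), P (x, y) := by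
  rw [stripMeasure_eq_prod] at h
  exact Measure.ae_ae_of_ae_prod (Measure.measurePreserving_swap.quasiMeasurePreserving.ae h)

theorem sineMode_zero (B : ℝ) (n : ℤ) : sineMode B n 0 = 0 := by simp [sineMode]

theorem sineMode_right {B : ℝ} (hB : 0 < B) (n : ℤ) : sineMode B n B = 0 := by
  rw [sineMode, div_mul_cancel₀ _ hB.ne', Real.sin_int_mul_pi]

theorem locallyIntegrableOn_of_memLp {I : Set ℝ} {f : ℝ → ℝ}
    (hf : MemLp f 2 (volume.restrict I)) : LocallyIntegrableOn f I :=
  locallyIntegrableOn_of_locallyIntegrable_restrict (hf.locallyIntegrable (by norm_num))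

/-- Sine coefficients of the second derivative of a function vanishing at `0` and `B`. -/
theorem integral_mul_sineMode_of_weakDeriv {B : ℝ} (hB : 0 < B) {w w₀ w₁ w₂ : ℝ → ℝ} (n : ℤ)
    (h₀ : MemLp w₀ 2 (volume.restrict (Ioo 0 B))) (h₁ : MemLp w₁ 2 (volume.restrict (Ioo 0 B)))
    (h₂ : MemLp w₂ 2 (volume.restrict (Ioo 0 B)))
    (H₀ : ∀ η, IsTest (Ioo 0 B) η → ∫ y in Ioo 0 B, w₀ y * deriv η y =
      - ∫ y in Ioo 0 B, w₁ y * η y)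
    (H₁ : ∀ η, IsTest (Ioo 0 B) η → ∫ y in Ioo 0 B, w₁ y * deriv η y =
      - ∫ y in Ioo 0 B, w₂ y * η y)
    (hw : Continuous w) (hww : ∀ᵐ y ∂volume.restrict (Ioo 0 B), w y = w₀ y)
    (hw0 : w 0 = 0) (hwB : w B = 0) :
    ∫ y in Ioo 0 B, w₂ y * sineMode B n y =
      -(n * Real.pi / B) ^ 2 * ∫ y in Ioo 0 B, w₀ y * sineMode B n y := by
  have hint : ∀ {r : ℝ → ℝ}, MemLp r 2 (volume.restrict (Ioo 0 B)) →
      IntegrableOn r (Ioc 0 B) := fun hr => by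
    rw [integrableOn_Ioc_iff_integrableOn_Ioo]
    exact hr.integrable (by norm_num)
  have hii : ∀ {r : ℝ → ℝ}, MemLp r 2 (volume.restrict (Ioo 0 B)) →
      IntervalIntegrable r volume 0 B := fun hr =>
    (intervalIntegrable_iff_integrableOn_Ioc_of_le hB.le).2 (hint hr)
  have hprim : ∀ {r s : ℝ → ℝ}, MemLp r 2 (volume.restrict (Ioo 0 B)) →
      MemLp s 2 (volume.restrict (Ioo 0 B)) →
      (∀ η, IsTest (Ioo 0 B) η → ∫ y in Ioo 0 B, r y * deriv η y =
        - ∫ y in Ioo 0 B, s y * η y) →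
      ∃ c, ∀ᵐ y ∂volume.restrict (Ioo 0 B), r y = c + ∫ t in (0 : ℝ)..y, s t := by
    intro r s hr hs H
    exact exists_ae_eq_primitive isOpen_Ioo ordConnected_Ioo (fun x hx => hx.1.le)
      (locallyIntegrableOn_of_memLp hr) (fun x hx => (hint hs).mono_set
        (Ioc_subset_Ioc_right hx.2.le)) H fun x hx => Ioo_subset_Ioo_right hx.2.le
  obtain ⟨c₁, hc₁⟩ := hprim h₁ h₂ H₁
  obtain ⟨c₀, hc₀⟩ := hprim h₀ h₁ H₀
  let W₁ : ℝ → ℝ := fun y => c₁ + ∫ t in (0 : ℝ)..y, w₂ t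
  let W₀ : ℝ → ℝ := fun y => c₀ + ∫ t in (0 : ℝ)..y, W₁ t
  have hcont : ∀ {r : ℝ → ℝ} (c : ℝ), IntervalIntegrable r volume 0 B →
      ContinuousOn (fun y => c + ∫ t in (0 : ℝ)..y, r t) (Icc 0 B) := by
    intro r c hr
    have := intervalIntegral.continuousOn_primitive_interval' hr left_mem_uIcc
    rw [uIcc_of_le hB.le] at this
    exact continuousOn_const.add this
  have hW₁c : ContinuousOn W₁ (Icc 0 B) := hcont c₁ (hii h₂)
  have hW₁i : IntervalIntegrable W₁ volume 0 B :=
    (uIcc_of_le hB.le ▸ hW₁c : ContinuousOn W₁ (uIcc 0 B)).intervalIntegrable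
  have hW₀c : ContinuousOn W₀ (Icc 0 B) := hcont c₀ hW₁i
  have hW₀ : ∀ᵐ y ∂volume.restrict (Ioo 0 B), W₀ y = w₀ y := by
    filter_upwards [hc₀, ae_restrict_mem measurableSet_Ioo] with y hy hyI
    rw [hy]
    simp only [W₀]
    congr 1
    apply intervalIntegral.integral_congr_ae
    rw [uIoc_of_le hyI.1.le]
    filter_upwards [(ae_restrict_iff' measurableSet_Ioo).1 hc₁] with t ht htI
    exact (ht ⟨htI.1, htI.2.trans_lt hyI.2⟩).symm
  -- Two continuous functions that agree almost everywhere agree up to the endpoints, so W₀ inherits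
  -- the zero boundary values.
  have hWw : EqOn W₀ w (Icc 0 B) := by
    refine Measure.eqOn_of_ae_eq (μ := volume) ?_ hW₀c hw.continuousOn ?_
    · rw [← restrict_Ioo_eq_restrict_Icc]
      filter_upwards [hW₀, hww] with y h h' using h.trans h'.symm
    · rw [interior_Icc, closure_Ioo hB.ne]
  have hW₀0 : W₀ 0 = 0 := (hWw ⟨le_rfl, hB.le⟩).trans hw0
  have hW₀B : W₀ B = 0 := (hWw ⟨hB.le, le_rfl⟩).trans hwB
  set κ : ℝ := n * Real.pi / B
  let s' : ℝ → ℝ := fun y => κ * Real.cos (κ * y)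
  have hlin : ∀ y, HasDerivAt (fun y => κ * y) κ y := fun y => by
    simpa using (hasDerivAt_id y).const_mul κ
  have hs : ∀ y, HasDerivAt (sineMode B n) (s' y) y := fun y => by
    have := (hlin y).sin
    rwa [mul_comm] at this
  have hs' : ∀ y, HasDerivAt s' (-κ ^ 2 * sineMode B n y) y := fun y => by
    have := (hlin y).cos.const_mul κ
    convert! this using 1
    simp only [sineMode, κ]
    ring
  have cs' : Continuous s' := by fun_prop
  have cs'' : Continuous fun y => -κ ^ 2 * sineMode B n y :=
    continuous_const.mul (continuous_sineMode B n)
  have ftc : ∀ {r r' : ℝ → ℝ}, (∀ y, HasDerivAt r (r' y) y) → Continuous r' →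
      ∀ x ∈ uIcc 0 B, r x = r 0 + ∫ t in (0 : ℝ)..x, r' t := by
    intro r r' hr hr' x _
    rw [intervalIntegral.integral_eq_sub_of_hasDerivAt (fun y _ => hr y)
      (hr'.intervalIntegrable _ _)]
    ring
  -- In the first integration by parts the boundary terms vanish because of the sine, as nothing is
  -- known about W₁ at the ends; in the second because of W₀.
  have k1 := integral_primitive_mul_primitive (p := W₁) (hii h₂) (cs'.intervalIntegrable 0 B)
    (by simp [W₁]) (ftc hs cs')
  have k2 := integral_primitive_mul_primitive (p := W₀) hW₁i (cs''.intervalIntegrable 0 B)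
    (by simp [W₀]) (ftc hs' cs'')
  rw [sineMode_right hB, sineMode_zero] at k1
  rw [hW₀0, hW₀B] at k2
  have uI : uIcc 0 B = Icc 0 B := uIcc_of_le hB.le
  have j1 : IntervalIntegrable (fun y => W₁ y * s' y) volume 0 B :=
    hW₁i.mul_continuousOn cs'.continuousOn
  rw [intervalIntegral.integral_add ((hii h₂).mul_continuousOn
    (continuous_sineMode B n).continuousOn) j1] at k1
  rw [intervalIntegral.integral_add j1 (by
    refine ContinuousOn.intervalIntegrable ?_
    rw [uI]
    exact hW₀c.mul cs''.continuousOn)] at k2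
  have e3 : ∫ y in (0 : ℝ)..B, W₀ y * (-κ ^ 2 * sineMode B n y) =
      -κ ^ 2 * ∫ y in Ioo 0 B, w₀ y * sineMode B n y := by
    rw [intervalIntegral.integral_of_le hB.le, integral_Ioc_eq_integral_Ioo,
      ← integral_const_mul]
    apply integral_congr_ae
    filter_upwards [hW₀] with y hy
    rw [hy]
    ring
  rw [e3] at k2
  rw [intervalIntegral.integral_of_le hB.le, integral_Ioc_eq_integral_Ioo] at k1
  linarith

/-- The second `y`-derivative acts on sine coefficients by multiplication with the eigenvalue. -/
theorem tensorPairing_sineMode_of_weakDeriv {B : ℝ} (hB : 0 < B) {G₀ G₁ G₂ : StripL2 B}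
    {φ : ℝ → ℝ} (hφ : IsTest (Ioi 0) φ) (n : ℤ)
    (H₀ : ∀ η, IsTest (Ioo 0 B) η → tensorPairing B G₀ φ (deriv η) = - tensorPairing B G₁ φ η)
    (H₁ : ∀ η, IsTest (Ioo 0 B) η → tensorPairing B G₁ φ (deriv η) = - tensorPairing B G₂ φ η)
    (hG : VanishesOn B G₀ (horizontalSides B)) :
    tensorPairing B G₂ φ (sineMode B n) =
      -(n * Real.pi / B) ^ 2 * tensorPairing B G₀ φ (sineMode B n) := by
  obtain ⟨v, hv, hvG, hv0⟩ := hG.exists_continuous hB (by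
    rintro p ⟨hp1, hp2⟩
    refine ⟨hp1, ?_⟩
    rcases hp2 with h | h
    · rw [h]; exact ⟨le_rfl, hB.le⟩
    · rw [h]; exact ⟨hB.le, le_rfl⟩)
  have hφ2 := hφ.memLp_self
  have hm : ∀ G : StripL2 B, MemLp (xMoment G φ) 2 (volume.restrict (Ioo 0 B)) := fun G =>
    memLp_xMoment (Lp.memLp G) hφ2
  have hp : ∀ (G : StripL2 B) {η : ℝ → ℝ}, MemLp η 2 (volume.restrict (Ioo 0 B)) →
      tensorPairing B G φ η = ∫ y in Ioo 0 B, xMoment G φ y * η y := fun G _ hη =>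
    tensorPairing_eq_xMoment (Lp.memLp G) hφ2 hη
  rw [hp G₂ (memLp_sineMode B n), hp G₀ (memLp_sineMode B n)]
  -- Restricting to the compact support of φ makes the moment of v continuous in y, so it has the
  -- boundary values of v.
  have hcont : Continuous (fun y => ∫ x in tsupport φ, v (x, y) * φ x) :=
    continuous_parametric_integral_of_continuous (f := fun y x => v (x, y) * φ x)
      (by have := hφ.continuous; fun_prop) hφ.compact
  have hvm : ∀ y, xMoment v φ y = ∫ x in tsupport φ, v (x, y) * φ x := by
    intro y
    have hz : ∀ x, x ∉ tsupport φ → v (x, y) * φ x = 0 := fun x hx => by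
      rw [image_eq_zero_of_notMem_tsupport hx, mul_zero]
    rw [xMoment, setIntegral_eq_integral_of_forall_compl_eq_zero
      (fun x hx => hz x fun h' => hx (hφ.tsupport_subset h')),
      setIntegral_eq_integral_of_forall_compl_eq_zero hz]
  refine integral_mul_sineMode_of_weakDeriv hB n (hm G₀) (hm G₁) (hm G₂)
    (w := xMoment v φ) (fun η hη => ?_) (fun η hη => ?_) ?_ ?_ ?_ ?_
  · rw [← hp G₀ hη.deriv.memLp_self, ← hp G₁ hη.memLp_self, H₀ η hη]
  · rw [← hp G₁ hη.deriv.memLp_self, ← hp G₂ hη.memLp_self, H₁ η hη]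
  · rw [show xMoment v φ = _ from funext hvm]
    exact hcont
  · filter_upwards [ae_ae_of_ae_stripMeasure' hvG] with y hy
    apply integral_congr_ae
    filter_upwards [hy] with x hx
    rw [hx]
  all_goals
    refine setIntegral_eq_zero_of_forall_eq_zero fun x hx => ?_
    rw [hv0 (x, _) ⟨mem_Ici.2 (le_of_lt hx), by simp⟩, zero_mul]

/-- The `y`-moments of a function vanishing at `x = 0` have zero trace. -/
theorem VanishesOn.exists_yMoment_trace {B : ℝ} (hB : 0 < B) {G : StripL2 B}
    (hG : VanishesOn B G (leftSide B)) {η : ℝ → ℝ} (hη : Continuous η) :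
    ∃ w, ContinuousOn w (Ici 0) ∧
      (∀ᵐ x ∂volume.restrict (Ioi 0), w x = yMoment B G η x) ∧ w 0 = 0 := by
  obtain ⟨v, hv, hvG, hv0⟩ := hG.exists_continuous hB (by
    rintro p ⟨hp1, hp2⟩
    exact ⟨by rw [hp1]; exact mem_Ici.2 le_rfl, hp2⟩)
  have e : ∀ x, yMoment B v η x = ∫ y in Icc 0 B, v (x, y) * η y := fun x => by
    rw [yMoment, integral_Icc_eq_integral_Ioo]
  refine ⟨yMoment B v η, ?_, ?_, ?_⟩
  · rw [show yMoment B v η = _ from funext e]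
    exact (continuous_parametric_integral_of_continuous (f := fun x y => v (x, y) * η y)
      (by fun_prop) isCompact_Icc).continuousOn
  · filter_upwards [ae_ae_of_ae_stripMeasure hvG] with x hx
    apply integral_congr_ae
    filter_upwards [hx] with y hy
    rw [hy]
  · refine setIntegral_eq_zero_of_forall_eq_zero fun y hy => ?_
    rw [hv0 (0, y) ⟨mem_singleton _, hy.1.le, hy.2.le⟩, zero_mul]

/-! ### Summation over the sine modes. -/

/-- An `L²(D)` pairing is nonnegative if all its sine modes are. -/
theorem integral_mul_nonneg_of_sineMode {B : ℝ} (hB : 0 < B) {R f : ℝ × ℝ → ℝ}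
    (hR : MemLp R 2 (stripMeasure B)) (hf : MemLp f 2 (stripMeasure B))
    (H : ∀ n : ℤ, 0 ≤ ∫ x in Ioi 0, yMoment B R (sineMode B n) x * yMoment B f (sineMode B n) x) :
    0 ≤ ∫ p in halfStrip B, R p * f p := by
  have mR := fun n => memLp_yMoment hR (memLp_sineMode B n)
  have mf := fun n => memLp_yMoment hf (memLp_sineMode B n)
  have hR' := hR
  have hf' := hf
  rw [stripMeasure_eq_prod] at hR' hf'
  have sR := hR'.slice_ae
  have sf := hf'.slice_ae
  have hb : ∀ᵐ x ∂volume.restrict (Ioi 0), HasSum (fun n : ℤ =>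
      yMoment B R (sineMode B n) x ^ 2 + yMoment B f (sineMode B n) x ^ 2)
      (B * (∫ y in Ioo 0 B, R (x, y) ^ 2) + B * ∫ y in Ioo 0 B, f (x, y) ^ 2) := by
    filter_upwards [sR, sf] with x h1 h2
    exact (hasSum_sq_integral_mul_sineMode hB h1).add (hasSum_sq_integral_mul_sineMode hB h2)
  -- The sum over n and the integral in x are interchanged; the dominating series of squares sums by
  -- Parseval to slice norms, which are integrable in x.
  have key := hasSum_integral_of_dominated_convergence (μ := volume.restrict (Ioi (0 : ℝ)))
    (F := fun (n : ℤ) x => yMoment B R (sineMode B n) x * yMoment B f (sineMode B n) x)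
    (f := fun x => B * ∫ y in Ioo 0 B, R (x, y) * f (x, y))
    (fun (n : ℤ) x => yMoment B R (sineMode B n) x ^ 2 + yMoment B f (sineMode B n) x ^ 2)
    (fun n => (mR n).1.mul (mf n).1)
    (fun n => Eventually.of_forall fun x => by
      rw [Real.norm_eq_abs, abs_le]
      constructor <;> nlinarith [sq_nonneg (yMoment B R (sineMode B n) x +
        yMoment B f (sineMode B n) x), sq_nonneg (yMoment B R (sineMode B n) x -
        yMoment B f (sineMode B n) x), sq_nonneg (yMoment B R (sineMode B n) x),
        sq_nonneg (yMoment B f (sineMode B n) x)])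
    (hb.mono fun x hx => hx.summable)
    (by
      refine Integrable.congr ((hR'.integrable_sq.integral_prod_left.const_mul B).add
        (hf'.integrable_sq.integral_prod_left.const_mul B)) ?_
      filter_upwards [hb] with x hx
      exact hx.tsum_eq.symm)
    (by
      filter_upwards [sR, sf] with x h1 h2
      exact hasSum_integral_mul_sineMode_mul hB h1 h2)
  have hnn := key.nonneg H
  rw [integral_const_mul] at hnn
  have hi := integral_prod _ (hR'.integrable_fun_mul hf')
  rw [← stripMeasure_eq_prod] at hi
  rw [hi]
  exact nonneg_of_mul_nonneg_right hnn hB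

theorem ae_memLp_slice {B : ℝ} {r : ℝ × ℝ → ℝ} (hr : MemLp r 2 (stripMeasure B)) :
    ∀ᵐ x ∂volume.restrict (Ioi (0 : ℝ)),
      MemLp (fun y => r (x, y)) 2 (volume.restrict (Ioo 0 B)) := by
  rw [stripMeasure_eq_prod] at hr
  exact hr.slice_ae

/-! ### Energy identities for a regular function of the space variables. -/

section Regular

variable {B : ℝ} {f : StripL2 B} {F : ℕ → ℕ → StripL2 B}

theorem HasRegularDerivs.eq_zero_zero (hF : HasRegularDerivs B f F) : f = F 0 0 :=
  (hF 0 0 (Or.inl (by norm_num))).eq_of_zero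

/-- Sine coefficients of `∂_x^i u` are the weak derivatives of the sine coefficients of `u`. -/
theorem HasRegularDerivs.tensorPairing_dx (hF : HasRegularDerivs B f F) {i : ℕ}
    (hi : i ≤ 5) {φ η : ℝ → ℝ} (hφ : IsTest (Ioi 0) φ)
    (hη : MemLp η 2 (volume.restrict (Ioo 0 B))) :
    tensorPairing B f (deriv^[i] φ) η = (-1) ^ i * tensorPairing B (F i 0) φ η := by
  refine tensorPairing_eq_of_forall_isTest (Lp.memLp f) (Lp.memLp (F i 0))
    (hφ.iterate_deriv i).memLp_self hφ.memLp_self (fun ψ hψ => ?_) hη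
  have := (hF i 0 (by unfold RegularOrder; omega)).tensorPairing_eq hφ hψ
  simpa using this

/-- The hypothesis ties each derivative to f rather than to the preceding one. Testing f with the
(i+1)-st derivative of φ, read in two ways, links neighbours after cancelling (−1)^i. -/
theorem HasRegularDerivs.integral_yMoment_mul_deriv (hF : HasRegularDerivs B f F) {i : ℕ}
    (hi : i < 5) {φ η : ℝ → ℝ} (hφ : IsTest (Ioi 0) φ)
    (hη : MemLp η 2 (volume.restrict (Ioo 0 B))) :
    ∫ x in Ioi 0, yMoment B (F i 0) η x * deriv φ x =
      - ∫ x in Ioi 0, yMoment B (F (i + 1) 0) η x * φ x := by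
  rw [← tensorPairing_eq_yMoment (Lp.memLp _) hφ.deriv.memLp_self hη,
    ← tensorPairing_eq_yMoment (Lp.memLp _) hφ.memLp_self hη]
  have h1 := hF.tensorPairing_dx hi.le hφ.deriv hη
  have h2 := hF.tensorPairing_dx (i := i + 1) hi hφ hη
  rw [Function.iterate_succ_apply, h1, pow_succ, mul_assoc, neg_one_mul] at h2
  exact mul_left_cancel₀ (pow_ne_zero i (by norm_num)) h2

theorem HasRegularDerivs.tensorPairing_dy (hF : HasRegularDerivs B f F) {j : ℕ}
    (hj : j < 4) {φ η : ℝ → ℝ} (hφ : IsTest (Ioi 0) φ) (hη : IsTest (Ioo 0 B) η) :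
    tensorPairing B (F 0 j) φ (deriv η) = - tensorPairing B (F 0 (j + 1)) φ η := by
  have h1 := (hF 0 j (by unfold RegularOrder; omega)).tensorPairing_eq hφ hη.deriv
  have h2 := (hF 0 (j + 1) (by unfold RegularOrder; omega)).tensorPairing_eq hφ hη
  rw [Function.iterate_succ_apply, h1, ← add_assoc, pow_succ, mul_assoc, neg_one_mul] at h2
  exact mul_left_cancel₀ (pow_ne_zero (0 + j) (by norm_num)) h2

theorem HasRegularDerivs.tensorPairing_dy_two (hB : 0 < B) (hF : HasRegularDerivs B f F)
    (hbc : BoundaryConditions B F) {φ : ℝ → ℝ} (hφ : IsTest (Ioi 0) φ) (n : ℤ) :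
    tensorPairing B (F 0 2) φ (sineMode B n) =
      -(n * Real.pi / B) ^ 2 * tensorPairing B (F 0 0) φ (sineMode B n) :=
  tensorPairing_sineMode_of_weakDeriv hB hφ n
    (fun _ hη => hF.tensorPairing_dy (by norm_num) hφ hη)
    (fun _ hη => hF.tensorPairing_dy (by norm_num) hφ hη)
    (by
      obtain ⟨v, h1, h2, h3⟩ := hbc.1
      exact ⟨v, h1, h2, fun p hp => h3 p (Or.inr hp)⟩)

/-- Two steps of order two: the first uses that u_yy vanishes on the horizontal sides, the second
that u does. -/
theorem HasRegularDerivs.tensorPairing_dy_four (hB : 0 < B) (hF : HasRegularDerivs B f F)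
    (hbc : BoundaryConditions B F) {φ : ℝ → ℝ} (hφ : IsTest (Ioi 0) φ) (n : ℤ) :
    tensorPairing B (F 0 4) φ (sineMode B n) =
      ((n * Real.pi / B) ^ 2) ^ 2 * tensorPairing B (F 0 0) φ (sineMode B n) := by
  rw [tensorPairing_sineMode_of_weakDeriv hB hφ n
    (fun _ hη => hF.tensorPairing_dy (by norm_num) hφ hη)
    (fun _ hη => hF.tensorPairing_dy (by norm_num) hφ hη) hbc.2.2,
    hF.tensorPairing_dy_two hB hbc hφ n]
  ring

/-- The x-derivatives are moved onto φ, so only the trace of u itself on the horizontal sides is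
needed, not that of its x-derivatives. -/
theorem HasRegularDerivs.tensorPairing_mixed (hB : 0 < B) (hF : HasRegularDerivs B f F)
    (hbc : BoundaryConditions B F) {i : ℕ} (hi : i ≤ 2) {φ : ℝ → ℝ} (hφ : IsTest (Ioi 0) φ)
    (n : ℤ) :
    tensorPairing B (F i 2) φ (sineMode B n) =
      -(n * Real.pi / B) ^ 2 * tensorPairing B (F i 0) φ (sineMode B n) := by
  have hs := memLp_sineMode B n
  have h1 : tensorPairing B (F 0 2) (deriv^[i] φ) (sineMode B n) =
      (-1) ^ i * tensorPairing B (F i 2) φ (sineMode B n) := by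
    refine tensorPairing_eq_of_forall_isTest (Lp.memLp _) (Lp.memLp _)
      (hφ.iterate_deriv i).memLp_self hφ.memLp_self (fun ψ hψ => ?_) hs
    have e1 := (hF i 2 (by unfold RegularOrder; omega)).tensorPairing_eq hφ hψ
    have e2 := (hF 0 2 (by unfold RegularOrder; omega)).tensorPairing_eq (hφ.iterate_deriv i) hψ
    rw [Function.iterate_zero, id, e1, pow_add] at e2
    norm_num at e2
    exact e2.symm
  have h2 := hF.tensorPairing_dy_two hB hbc (hφ.iterate_deriv i) n
  have h3 := hF.tensorPairing_dx (i := i) (by omega) hφ hs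
  rw [← hF.eq_zero_zero, h1, h3] at h2
  refine mul_left_cancel₀ (pow_ne_zero i (by norm_num : (-1 : ℝ) ≠ 0)) ?_
  rw [h2]
  ring

theorem yMoment_ae_eq_of_tensorPairing {G₁ G₂ : StripL2 B} {η : ℝ → ℝ} {s : ℝ}
    (hη : MemLp η 2 (volume.restrict (Ioo 0 B)))
    (H : ∀ φ, IsTest (Ioi 0) φ → tensorPairing B G₁ φ η = s * tensorPairing B G₂ φ η) :
    ∀ᵐ x ∂volume.restrict (Ioi 0), yMoment B G₁ η x = s * yMoment B G₂ η x :=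
  ae_eq_of_forall_isTest isOpen_Ioi (memLp_yMoment (Lp.memLp _) hη)
    (memLp_yMoment (Lp.memLp _) hη) fun φ hφ => by
      rw [← tensorPairing_eq_yMoment (Lp.memLp _) hφ.memLp_self hη,
        ← tensorPairing_eq_yMoment (Lp.memLp _) hφ.memLp_self hη]
      exact H φ hφ

theorem sq_le_of_ne_zero (hB : 0 < B) {n : ℤ} (hn : n ≠ 0) :
    Real.pi ^ 2 / B ^ 2 ≤ (n * Real.pi / B) ^ 2 := by
  rw [div_pow, mul_pow]
  gcongr
  have : (1 : ℝ) ≤ (n : ℝ) ^ 2 := by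
    have : (1 : ℤ) ≤ n ^ 2 := by
      have := sq_pos_of_ne_zero hn
      omega
    exact_mod_cast this
  nlinarith [sq_nonneg Real.pi]

theorem yMoment_sineMode_zero (G : ℝ × ℝ → ℝ) (x : ℝ) : yMoment B G (sineMode B 0) x = 0 := by
  simp [yMoment, sineMode]

/-- The energy inequality for the linear part of the operator. -/
theorem HasRegularDerivs.energy_nonneg {γ a : ℝ} (hB : 0 < B) (hγ : γ ≤ 0)
    (ha : a = Real.pi ^ 2 / B ^ 2) (hF : HasRegularDerivs B f F) (hbc : BoundaryConditions B F) :
    0 ≤ ∫ p in halfStrip B, (F 4 0 p + 2 * F 2 2 p + F 0 4 p + γ * (F 2 0 p + F 0 2 p)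
      + (F 3 0 p + F 1 2 p) - F 5 0 p - (a ^ 2 + |γ| * a) * F 0 0 p) * F 0 0 p := by
  set c := a ^ 2 + |γ| * a
  have m : ∀ i j, MemLp (F i j) 2 (stripMeasure B) := fun i j => Lp.memLp _
  have hR : MemLp (fun p => F 4 0 p + 2 * F 2 2 p + F 0 4 p + γ * (F 2 0 p + F 0 2 p)
      + (F 3 0 p + F 1 2 p) - F 5 0 p - c * F 0 0 p) 2 (stripMeasure B) :=
    ((((((m 4 0).add ((m 2 2).const_mul 2)).add (m 0 4)).add
      (((m 2 0).add (m 0 2)).const_mul γ)).add ((m 3 0).add (m 1 2))).sub (m 5 0)).sub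
      ((m 0 0).const_mul c)
  refine integral_mul_nonneg_of_sineMode hB hR (m 0 0) fun n => ?_
  -- The mode n = 0 is identically zero; it occurs only because the modes are indexed by ℤ.
  rcases eq_or_ne n 0 with rfl | hn
  · simp [yMoment_sineMode_zero]
  set lam : ℝ := (n * Real.pi / B) ^ 2
  have hs := memLp_sineMode B n
  have hal : a ≤ lam := ha ▸ sq_le_of_ne_zero hB hn
  have ha0 : 0 ≤ a := by rw [ha]; positivity
  -- The decay rate comes from here: λ² + |γ|λ increases with λ ≥ 0, and a is the lowest eigenvalue.
  have hc : c ≤ lam ^ 2 + |γ| * lam := by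
    have := abs_nonneg γ
    simp only [c]
    gcongr
  have key := energy_nonneg_of_weakDeriv (f := fun i => yMoment B (F i 0) (sineMode B n))
    (ha0.trans hal) hγ hc (fun i _ => memLp_yMoment (m i 0) hs)
    (fun i hi φ hφ => hF.integral_yMoment_mul_deriv hi hφ hs)
    (VanishesOn.exists_yMoment_trace hB (by
      obtain ⟨v, h1, h2, h3⟩ := hbc.1
      exact ⟨v, h1, h2, fun p hp => h3 p (Or.inl hp)⟩) (continuous_sineMode B n))
    (VanishesOn.exists_yMoment_trace hB hbc.2.1 (continuous_sineMode B n))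
  refine key.trans_eq (integral_congr_ae ?_)
  have e22 := yMoment_ae_eq_of_tensorPairing hs fun φ hφ =>
    hF.tensorPairing_mixed hB hbc (i := 2) le_rfl hφ n
  have e12 := yMoment_ae_eq_of_tensorPairing hs fun φ hφ =>
    hF.tensorPairing_mixed hB hbc (i := 1) (by norm_num) hφ n
  have e02 := yMoment_ae_eq_of_tensorPairing hs fun φ hφ =>
    hF.tensorPairing_dy_two hB hbc hφ n
  have e04 := yMoment_ae_eq_of_tensorPairing hs fun φ hφ =>
    hF.tensorPairing_dy_four hB hbc hφ n
  have sl : ∀ i j, ∀ᵐ x ∂volume.restrict (Ioi (0 : ℝ)),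
      Integrable (fun y => F i j (x, y) * sineMode B n y) (volume.restrict (Ioo 0 B)) := by
    intro i j
    filter_upwards [ae_memLp_slice (m i j)] with x hx using hx.integrable_fun_mul hs
  filter_upwards [e22, e12, e02, e04, sl 4 0, sl 2 2, sl 0 4, sl 2 0, sl 0 2, sl 3 0, sl 1 2,
    sl 5 0, sl 0 0] with x h22 h12 h02 h04 i40 i22 i04 i20 i02 i30 i12 i50 i00
  have hlin : yMoment B (fun p => F 4 0 p + 2 * F 2 2 p + F 0 4 p + γ * (F 2 0 p + F 0 2 p)
      + (F 3 0 p + F 1 2 p) - F 5 0 p - c * F 0 0 p) (sineMode B n) x =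
      yMoment B (F 4 0) (sineMode B n) x + 2 * yMoment B (F 2 2) (sineMode B n) x
      + yMoment B (F 0 4) (sineMode B n) x + γ * (yMoment B (F 2 0) (sineMode B n) x
      + yMoment B (F 0 2) (sineMode B n) x) + (yMoment B (F 3 0) (sineMode B n) x
      + yMoment B (F 1 2) (sineMode B n) x) - yMoment B (F 5 0) (sineMode B n) x
      - c * yMoment B (F 0 0) (sineMode B n) x := by
    have a1 := Integrable.fun_add i40 (i22.const_mul 2)
    have a2 := Integrable.fun_add a1 i04
    have a3 := Integrable.fun_add i20 i02
    have a4 := Integrable.fun_add a2 (a3.const_mul γ)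
    have a5 := Integrable.fun_add i30 i12
    have a6 := Integrable.fun_add a4 a5
    have a7 := Integrable.sub a6 i50
    have a8 := integral_sub a7 (i00.const_mul c)
    simp only [Pi.sub_apply] at a8
    rw [integral_sub a6 i50, integral_add a4 a5, integral_add i30 i12,
      integral_add a2 (a3.const_mul γ), integral_add a1 i04, integral_add i40 (i22.const_mul 2),
      integral_const_mul, integral_const_mul, integral_const_mul, integral_add i20 i02] at a8
    unfold yMoment
    rw [← a8]
    congr 1
    funext y
    ring
  rw [hlin, h22, h12, h02, h04]
  ring

/-- The transport term does not contribute to the energy. -/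
theorem HasRegularDerivs.integral_sq_mul_dx_eq_zero (hB : 0 < B) (hF : HasRegularDerivs B f F)
    (hbc : BoundaryConditions B F)
    (hint : Integrable (fun p => F 0 0 p ^ 2 * F 1 0 p) (stripMeasure B)) :
    ∫ p in halfStrip B, F 0 0 p ^ 2 * F 1 0 p = 0 := by
  have hsides : leftSide B ⊆ Ici 0 ×ˢ Icc 0 B := by
    rintro p ⟨hp1, hp2⟩
    exact ⟨by rw [hp1]; exact mem_Ici.2 le_rfl, hp2⟩
  have hbc0 : VanishesOn B (F 0 0) (leftSide B) := by
    obtain ⟨v, h1, h2, h3⟩ := hbc.1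
    exact ⟨v, h1, h2, fun p hp => h3 p (Or.inl hp)⟩
  obtain ⟨v, hv, hvF, hv0⟩ := hbc0.exists_continuous hB hsides
  obtain ⟨w, hw, hwF, -⟩ := hbc.2.1.exists_continuous hB hsides
  have mv : MemLp v 2 (stripMeasure B) := (Lp.memLp (F 0 0)).ae_eq hvF.symm
  have mw : MemLp w 2 (stripMeasure B) := (Lp.memLp (F 1 0)).ae_eq hwF.symm
  have hint' : Integrable (fun p => v p ^ 2 * w p) (stripMeasure B) := by
    refine hint.congr ?_
    filter_upwards [hvF, hwF] with p h1 h2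
    rw [h1, h2]
  have hcont : ∀ y, Continuous fun x => w (x, y) := fun y => by fun_prop
  -- Tested against η(y), the identity is the primitive formula for a y-moment together with Fubini.
  -- Both sides are continuous in y, so it holds for every y and not merely almost every y.
  have prim : ∀ x, 0 ≤ x → ∀ y ∈ Ioo 0 B, v (x, y) = ∫ s in (0 : ℝ)..x, w (s, y) := by
    intro x hx
    refine Measure.eqOn_open_of_ae_eq (μ := volume) (f := fun y => v (x, y))
      (g := fun y => ∫ s in (0 : ℝ)..x, w (s, y)) ?_ isOpen_Ioo (by fun_prop)
      (intervalIntegral.continuous_parametric_intervalIntegral_of_continuous'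
        (f := fun y s => w (s, y)) (by fun_prop) 0 x).continuousOn
    have hgc : Continuous fun y => ∫ s in (0 : ℝ)..x, w (s, y) :=
      intervalIntegral.continuous_parametric_intervalIntegral_of_continuous'
        (f := fun y s => w (s, y)) (by fun_prop) 0 x
    have hbd : ∀ {r : ℝ → ℝ}, Continuous r → MemLp r 2 (volume.restrict (Ioo 0 B)) := by
      intro r hr
      obtain ⟨C, hC⟩ := isCompact_Icc.exists_bound_of_continuousOn (s := Icc 0 B) hr.continuousOn
      refine MemLp.of_bound hr.aestronglyMeasurable C ?_
      filter_upwards [ae_restrict_mem measurableSet_Ioo] with y hy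
      exact hC y ⟨hy.1.le, hy.2.le⟩
    have := ae_eq_of_forall_isTest isOpen_Ioo (s := 1) (hbd (r := fun y => v (x, y)) (by fun_prop))
      (hbd hgc) fun η hη => ?_
    · filter_upwards [this] with y hy
      rw [hy, one_mul]
    obtain ⟨p, hp, hpe⟩ := HalfLineH1.exists_of_weakDeriv
      (memLp_yMoment (Lp.memLp (F 0 0)) hη.memLp_self)
      (memLp_yMoment (Lp.memLp (F 1 0)) hη.memLp_self)
      (fun φ hφ => hF.integral_yMoment_mul_deriv (i := 0) (by norm_num) hφ hη.memLp_self)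
    have hηc := hη.continuous
    have cm : ∀ {r : ℝ × ℝ → ℝ}, Continuous r → Continuous (yMoment B r η) := by
      intro r hr
      rw [show yMoment B r η = fun x => ∫ y in Icc 0 B, r (x, y) * η y from funext fun x => by
        rw [yMoment, integral_Icc_eq_integral_Ioo]]
      exact continuous_parametric_integral_of_continuous (f := fun x y => r (x, y) * η y)
        (by fun_prop) isCompact_Icc
    have me : ∀ {r : ℝ × ℝ → ℝ} {G : StripL2 B}, r =ᵐ[stripMeasure B] G →
        ∀ᵐ x ∂volume.restrict (Ioi (0 : ℝ)), yMoment B G η x = yMoment B r η x := by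
      intro r G h
      filter_upwards [ae_ae_of_ae_stripMeasure h] with x hx
      apply integral_congr_ae
      filter_upwards [hx] with y hy
      rw [hy]
    have hp' := hp.congr_deriv (q' := yMoment B w η) ((me hwF).mono fun x hx => hx.symm)
    have hpv : EqOn p (yMoment B v η) (Ici 0) := hp'.eqOn (cm hv).continuousOn (by
      filter_upwards [hpe, me hvF] with x h1 h2 using h1.trans h2)
    have hz : yMoment B v η 0 = 0 := setIntegral_eq_zero_of_forall_eq_zero fun y hy => by
      rw [hv0 (0, y) ⟨mem_singleton _, hy.1.le, hy.2.le⟩, zero_mul]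
    have h1 := hp'.eq_primitive x hx
    rw [hpv (mem_Ici.2 hx), hpv (mem_Ici.2 le_rfl), hz, zero_add] at h1
    rw [one_mul]
    refine h1.trans ?_
    have hcpt : Integrable (Function.uncurry fun s y => w (s, y) * η y)
        ((volume.restrict (Ioc 0 x)).prod (volume.restrict (Ioo 0 B))) := by
      rw [Measure.prod_restrict]
      refine IntegrableOn.mono_set (t := Icc 0 x ×ˢ Icc 0 B) ?_
        (prod_mono Ioc_subset_Icc_self Ioo_subset_Icc_self)
      exact ContinuousOn.integrableOn_compact (isCompact_Icc.prod isCompact_Icc)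
        (by unfold Function.uncurry; fun_prop)
    simp only [yMoment, intervalIntegral.integral_of_le hx]
    rw [integral_integral_swap hcpt]
    simp only [integral_mul_const]
  rw [show ∫ p in halfStrip B, F 0 0 p ^ 2 * F 1 0 p = ∫ p in halfStrip B, v p ^ 2 * w p from
    integral_congr_ae (by
      filter_upwards [hvF, hwF] with p h1 h2
      rw [h1, h2])]
  have slices : ∀ {r : ℝ × ℝ → ℝ}, MemLp r 2 (stripMeasure B) →
      ∀ᵐ y ∂volume.restrict (Ioo 0 B), MemLp (fun x => r (x, y)) 2 (volume.restrict (Ioi 0)) := by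
    intro r hr
    rw [stripMeasure_eq_prod] at hr
    exact hr.swap.slice_ae
  have hint2 := hint'
  rw [stripMeasure_eq_prod] at hint2
  -- On almost every horizontal line v is in H¹(0, ∞), so it tends to 0 at infinity; it vanishes at
  -- x = 0, and the integrand is the derivative of v³/3.
  have hy : ∀ᵐ y ∂volume.restrict (Ioo 0 B), ∫ x in Ioi 0, v (x, y) ^ 2 * w (x, y) = 0 := by
    filter_upwards [slices mv, slices mw, hint2.prod_left_ae, ae_restrict_mem measurableSet_Ioo]
      with y h1 h2 h3 hyI
    let W : ℝ → ℝ := fun x => ∫ s in (0 : ℝ)..x, w (s, y)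
    have hWv : ∀ x, 0 ≤ x → v (x, y) = W x := fun x hx => prim x hx y hyI
    have hH1 : HalfLineH1 (fun x => v (x, y)) (fun x => w (x, y)) := ⟨h1, h2, fun x hx => by
      rw [prim x hx y hyI, hWv 0 le_rfl]
      simp [W]⟩
    have hWd : ∀ x, HasDerivAt W (w (x, y)) x := fun x =>
      intervalIntegral.integral_hasDerivAt_right ((hcont y).intervalIntegrable _ _)
        ((hcont y).stronglyMeasurableAtFilter _ _) (hcont y).continuousAt
    have hW0 : Tendsto W atTop (𝓝 0) := by
      refine hH1.tendsto_zero.congr' ?_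
      filter_upwards [eventually_ge_atTop 0] with x hx using hWv x hx
    have hcube : ∀ x, HasDerivAt (fun x => W x ^ 3 / 3) (W x ^ 2 * w (x, y)) x := fun x => by
      have := ((hWd x).pow 3).div_const 3
      convert! this using 1
      ring
    have hcg : EqOn (fun x => v (x, y) ^ 2 * w (x, y)) (fun x => W x ^ 2 * w (x, y)) (Ioi 0) :=
      fun x hx => by simp only [hWv x (le_of_lt hx)]
    rw [setIntegral_congr_fun measurableSet_Ioi hcg,
      integral_Ioi_of_hasDerivAt_of_tendsto (hcube 0).continuousAt.continuousWithinAt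
        (fun x _ => hcube x) (IntegrableOn.congr_fun h3 hcg measurableSet_Ioi)
        (m := 0) (by simpa using (hW0.pow 3).div_const 3)]
    simp [W]
  rw [show halfStrip B = Ioi 0 ×ˢ Ioo 0 B from rfl, Measure.volume_eq_prod,
    ← Measure.prod_restrict, integral_prod_symm _ hint2, integral_congr_ae hy, integral_zero]

end Regular

/-! ### Dissipation and decay in time. -/

/-- The energy dissipation inequality at a fixed time. -/
theorem HasRegularDerivs.inner_le {B γ a : ℝ} (hB : 0 < B) (hγ : γ ≤ 0)
    (ha : a = Real.pi ^ 2 / B ^ 2) {f W : StripL2 B} {F : ℕ → ℕ → StripL2 B}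
    (hF : HasRegularDerivs B f F) (hbc : BoundaryConditions B F)
    (heq : ∀ᵐ p ∂stripMeasure B, W p + (F 4 0 p + 2 * F 2 2 p + F 0 4 p)
      + γ * (F 2 0 p + F 0 2 p) + (F 3 0 p + F 1 2 p) + f p * F 1 0 p - F 5 0 p = 0) :
    inner ℝ f W ≤ -((a ^ 2 + |γ| * a) * ‖f‖ ^ 2) := by
  set c := a ^ 2 + |γ| * a
  have hen := hF.energy_nonneg hB hγ ha hbc
  have htr := hF.integral_sq_mul_dx_eq_zero hB hbc
  obtain rfl := hF.eq_zero_zero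
  have m : ∀ i j, MemLp (F i j) 2 (stripMeasure B) := fun i j => Lp.memLp _
  have hR : MemLp (fun p => F 4 0 p + 2 * F 2 2 p + F 0 4 p + γ * (F 2 0 p + F 0 2 p)
      + (F 3 0 p + F 1 2 p) - F 5 0 p - c * F 0 0 p) 2 (stripMeasure B) :=
    ((((((m 4 0).add ((m 2 2).const_mul 2)).add (m 0 4)).add
      (((m 2 0).add (m 0 2)).const_mul γ)).add ((m 3 0).add (m 1 2))).sub (m 5 0)).sub
      ((m 0 0).const_mul c)
  have iR := hR.integrable_fun_mul (m 0 0)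
  have iW := (Lp.memLp W).integrable_fun_mul (m 0 0)
  have i0 := ((m 0 0).integrable_fun_mul (m 0 0)).const_mul c
  have iW0 := Integrable.fun_add iW i0
  have iall := Integrable.fun_add iW0 iR
  -- The equation writes u²u_x as a sum of products of L² functions, so its integrability needs no
  -- Sobolev embedding.
  have hpt : ∀ᵐ p ∂stripMeasure B, F 0 0 p ^ 2 * F 1 0 p = -(W p * F 0 0 p
      + c * (F 0 0 p * F 0 0 p) + (F 4 0 p + 2 * F 2 2 p + F 0 4 p + γ * (F 2 0 p + F 0 2 p)
      + (F 3 0 p + F 1 2 p) - F 5 0 p - c * F 0 0 p) * F 0 0 p) := by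
    filter_upwards [heq] with p hp
    linear_combination F 0 0 p * hp
  have h0 := htr (iall.neg.congr (hpt.mono fun p hp => hp.symm))
  rw [integral_congr_ae hpt, integral_neg, integral_add iW0 iR, integral_add iW i0,
    integral_const_mul] at h0
  have e1 : inner ℝ (F 0 0) W = ∫ p in halfStrip B, W p * F 0 0 p := by
    rw [L2.inner_def]
    simp
  have e2 : ‖F 0 0‖ ^ 2 = ∫ p in halfStrip B, F 0 0 p * F 0 0 p := by
    rw [← real_inner_self_eq_norm_sq, L2.inner_def]
    simp [sq]
  rw [e1, e2]
  linarith

/-- Exponential decay of the norm from a dissipation inequality holding for almost every time. -/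
theorem norm_sq_le_exp_of_ae_inner_le {E : Type*} [NormedAddCommGroup E] [InnerProductSpace ℝ E]
    [CompleteSpace E] {u v : ℝ → E} {c : ℝ}
    (hv : ∀ T > 0, MemLp v ∞ (volume.restrict (Ioo 0 T)))
    (hu : ∀ t ≥ 0, u t = u 0 + ∫ s in (0 : ℝ)..t, v s)
    (H : ∀ᵐ t ∂volume.restrict (Ioi (0 : ℝ)), inner ℝ (u t) (v t) ≤ -(c * ‖u t‖ ^ 2)) :
    ∀ t ≥ 0, ‖u t‖ ^ 2 ≤ ‖u 0‖ ^ 2 * Real.exp (-(2 * c) * t) := by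
  intro T hT0
  rcases hT0.eq_or_lt with rfl | hT
  · simp
  have uI : uIcc 0 T = Icc 0 T := uIcc_of_le hT.le
  have hvT := hv T hT
  have hii : IntervalIntegrable v volume 0 T :=
    (intervalIntegrable_iff_integrableOn_Ioc_of_le hT.le).2 (by
      rw [integrableOn_Ioc_iff_integrableOn_Ioo]
      exact hvT.integrable (by simp))
  obtain ⟨C, hC⟩ : ∃ C, ∀ᵐ t ∂volume.restrict (Ioc 0 T), ‖v t‖ ≤ C := by
    refine ⟨(eLpNorm v ∞ (volume.restrict (Ioo 0 T))).toReal, ?_⟩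
    rw [← restrict_Ioo_eq_restrict_Ioc]
    have h1 := ae_le_eLpNormEssSup (f := v) (μ := volume.restrict (Ioo 0 T))
    filter_upwards [h1] with t ht
    rw [← toReal_enorm]
    refine ENNReal.toReal_mono hvT.2.ne ?_
    rwa [eLpNorm_exponent_top]
  rw [ae_restrict_iff' measurableSet_Ioc] at hC
  have hiis : ∀ s ∈ Icc 0 T, IntervalIntegrable v volume 0 s := fun s hs =>
    hii.mono_set (by rw [uI, uIcc_of_le hs.1]; exact Icc_subset_Icc_right hs.2)
  -- The essential bound on v makes u Lipschitz, so e^{2ct}‖u‖² is absolutely continuous and an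
  -- almost everywhere sign of its derivative suffices.
  have hlip : LipschitzOnWith (Real.toNNReal C) u (uIcc 0 T) := by
    rw [uI]
    refine LipschitzOnWith.of_dist_le_mul fun s hs t ht => ?_
    rw [dist_eq_norm, hu s hs.1, hu t ht.1, add_sub_add_left_eq_sub,
      intervalIntegral.integral_interval_sub_left (hiis s hs) (hiis t ht), Real.dist_eq]
    refine (intervalIntegral.norm_integral_le_of_norm_le_const_ae ?_).trans
      (mul_le_mul_of_nonneg_right (Real.le_coe_toNNReal C) (abs_nonneg _))
    filter_upwards [hC] with r hr hrI
    refine hr ⟨?_, ?_⟩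
    · exact (le_min ht.1 hs.1).trans_lt hrI.1
    · exact hrI.2.trans (max_le ht.2 hs.2)
  have hnorm : AbsolutelyContinuousOnInterval (fun t => ‖u t‖) 0 T :=
    (lipschitzWith_one_norm.comp_lipschitzOnWith hlip).absolutelyContinuousOnInterval
  have hexp : AbsolutelyContinuousOnInterval (fun t => Real.exp (2 * c * t)) 0 T :=
    ContDiffOn.absolutelyContinuousOnInterval
      (by fun_prop : ContDiff ℝ 1 fun t => Real.exp (2 * c * t)).contDiffOn
  have hM := hexp.fun_mul (hnorm.fun_mul hnorm)
  have hftc := hM.integral_deriv_eq_sub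
  have hneg : ∫ t in (0 : ℝ)..T, deriv (fun t => Real.exp (2 * c * t) * (‖u t‖ * ‖u t‖)) t ≤ 0 := by
    rw [intervalIntegral.integral_of_le hT.le, integral_Ioc_eq_integral_Ioo]
    refine integral_nonpos_of_ae ?_
    rw [EventuallyLE, ae_restrict_iff' measurableSet_Ioo]
    filter_upwards [hii.ae_hasDerivAt_integral, (ae_restrict_iff' measurableSet_Ioi).1 H]
      with t h1 h2 htI
    have hd := (h1 (by rw [uI]; exact ⟨htI.1.le, htI.2.le⟩) 0 left_mem_uIcc).const_add (u 0)
    have hud : HasDerivAt u (v t) t := by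
      refine hd.congr_of_eventuallyEq ?_
      filter_upwards [Ioi_mem_nhds htI.1] with s hs using hu s (le_of_lt hs)
    have hlin : HasDerivAt (fun t => 2 * c * t) (2 * c) t := by
      simpa using (hasDerivAt_id t).const_mul (2 * c)
    have hprod := hlin.exp.mul hud.norm_sq
    have e : (fun t => Real.exp (2 * c * t) * (‖u t‖ * ‖u t‖)) =
        (fun t => Real.exp (2 * c * t)) * (fun t => ‖u t‖ ^ 2) := by
      funext s
      simp only [Pi.mul_apply]
      ring
    rw [e, hprod.deriv]
    have h3 := h2 htI.1
    have h4 : Real.exp (2 * c * t) * (2 * c) * ‖u t‖ ^ 2 + Real.exp (2 * c * t) *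
        (2 * inner ℝ (u t) (v t)) = 2 * Real.exp (2 * c * t) *
        (c * ‖u t‖ ^ 2 + inner ℝ (u t) (v t)) := by ring
    rw [h4]
    exact mul_nonpos_of_nonneg_of_nonpos (by positivity) (by linarith)
  rw [hftc, mul_zero, Real.exp_zero, one_mul] at hneg
  rw [neg_mul, Real.exp_neg, ← div_eq_mul_inv, le_div_iff₀ (Real.exp_pos _)]
  nlinarith

theorem theorem6p4 (B k γ a χ : ℝ) (hB : 0 < B) (hk : k ∈ Set.Ioo (0 : ℝ) (1 / 4)) (hγ : γ ≤ 0)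
    (ha : a = Real.pi ^ 2 / B ^ 2) (hχ : χ = 2 * (|γ| / a + 1) * a ^ 2)
    (u₀ : StripL2 B) (hu₀ : AdmissibleData B k u₀)
    (u : ℝ → StripL2 B) (hu : IsGlobalRegularSolution B γ u₀ u) :
    ∀ t ≥ 0, ‖u t‖ ^ 2 ≤ ‖u₀‖ ^ 2 * Real.exp (-χ * t) := by
  obtain ⟨U, V, hU, -, hreg, hint, heq, hbc, rfl⟩ := hu
  have ha0 : 0 < a := by
    rw [ha]
    have := Real.pi_pos
    positivity
  -- Twice the coercivity constant, since the derivative of ‖u‖² is twice the inner product of u and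
  -- u_t.
  have hχ' : χ = 2 * (a ^ 2 + |γ| * a) := by
    rw [hχ]
    field_simp
    ring
  rw [hχ']
  refine norm_sq_le_exp_of_ae_inner_le (fun T hT => (hreg T hT).2.2.1) hint ?_
  filter_upwards [hU, heq, hbc] with t h1 h2 h3
  exact h1.inner_le hB hγ ha h3 h2
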